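/- Let $\mathcal K$ be a Gray-category (a category enriched in strict 2-categories with the Gray tensor product). Write $\cdot$ for the composition of 2-cells within a hom-2-category, $GF$, $G\alpha$, $\beta F$ for composition along an object, and, for $\beta: G\Rightarrow G'$, $\alpha: F\Rightarrow F'$, write $\beta_\alpha: G'\alpha\cdot\beta F\Rrightarrow \beta F'\cdot G\alpha$ for the invertible interchange 3-cell. *Pseudoadjunction.* For 1-cells $U: A\to X$ and $F: X\to A$, a pseudoadjunction $F\dashv U$ with unit $\eta: 1_X\Rightarrow UF$ consists of $\eta$, a counit $\varepsilon: FU\Rightarrow 1_A$ and invertible 3-cells $s: 1_F\Rrightarrow \varepsilon F\cdot F\eta$ and $t: U\varepsilon\cdot\eta U\Rrightarrow 1_U$, such that the pasted 3-cells $$\eta \xRightarrow{\,Us\,} U\varepsilon F\cdot UF\eta\cdot\eta \xRightarrow{\,\eta_\eta\,} U\varepsilon F\cdot\eta UF\cdot\eta \xRightarrow{\,tF\,}\eta ,\qquad \varepsilon \xRightarrow{\,sU\,} \varepsilon\cdot\varepsilon FU\cdot F\eta U \xRightarrow{\,\varepsilon_\varepsilon\,} \varepsilon\cdot FU\varepsilon\cdot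 F\eta U \xRightarrow{\,Ft\,}\varepsilon$$ are the identities of $\eta$ and of $\varepsilon$. *Left pseudoextension.* Let $J: X\to A$, $H: X\to B$, $L: A\to B$ be 1-cells. A 2-cell $\eta: H\Rightarrow LJ$ exhibits $L$ as a left pseudoextension of $H$ along $J$ if for each $K: A\to B$ and $f: H\Rightarrow KJ$ there are a 2-cell $f^\sharp: L\Rightarrow K$ and an invertible 3-cell $\mu(f): f^\sharp J\cdot\eta\Rrightarrow f$ such that for each $k: L\Rightarrow K$ and each 3-cell $\omega: kJ\cdot\eta\Rrightarrow f$ there is a unique 3-cell $\bar\omega: k\Rrightarrow f^\sharp$ with $\omega = \mu(f)\circ(\bar\omega J\cdot\eta)$, and $\bar\omega$ is invertible whenever $\omega$ is. (Equivalently, $k\mapsto kJ\cdot\eta$ is an equivalence of categories $\mathcal K(A,B)(L,K)\to\mathcal K(X,B)(H,KJ)$ for every $K$.) The pseudoextension is preserved by a 1-cell $G: B\to C$ if $G\eta$ exhibits $GL$ as a left pseudoextension of $GH$ along $J$; it is absolute if it is preserved by every 1-cell $G: B\to C$, for every object $C$. Left pseudoliftings, their preservation (by precomposition) and absolute left pseudoliftings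 are the same notions in the horizontal dual $\mathcal K^{\mathrm{op}}$, which reverses 1-cells. **Theorem (pseudo-Bénabou theorem).** Let $U: A\to X$ and $F: X\to A$ be 1-cells in a Gray-category $\mathcal K$ and let $\eta: 1_X\Rightarrow UF$ be a 2-cell. The following are equivalent: 1. there is a pseudoadjunction $F\dashv U$ with unit $\eta$; 2. $\eta$ exhibits $U$ as an absolute left pseudoextension of $1_X$ along $F$; 3. $\eta$ exhibits $U$ as a left pseudoextension of $1_X$ along $F$, and this pseudoextension is preserved by $F$; 4. $\eta$ exhibits $F$ as an absolute left pseudolifting of $1_X$ through $U$; 5. $\eta$ exhibits $F$ as a left pseudolifting of $1_X$ through $U$, and this pseudolifting is preserved by $U$. -/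

import Mathlib

open CategoryTheory CategoryTheory.Bicategory

universe w v₂ v₁ u

/-- A Gray-category, that is, a category enriched in strict 2-categories with the Gray tensor
product, presented through its cells.

Each `Hom A B` is a strict 2-category: its objects are the 1-cells `A → B`, its 1-morphisms are
the 2-cells and its 2-morphisms are the 3-cells. Composition of 1-cells is written in
applicative order: `comp G F` is `G F`, for `F : A → B` and `G : B → C`. Composition along an
object is given by the strict 2-functors `G (-)` (fields `wl`, `wl₃`) and `(-) F` (fields `wr`,
`wr₃`), together with the invertible interchange 3-cells
`β_α : G' α ∘ β F ⇛ β F' ∘ G α` (field `interchange`).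

Heterogeneous equality is used to state an equality of cells whose boundaries are equal by
another (strict) axiom, but not definitionally so. -/
structure GrayCategory where
  /-- the objects -/
  Obj : Type u
  /-- the hom-2-categories -/
  Hom : Obj → Obj → Type v₁
  [homBicategory : ∀ A B, Bicategory.{w, v₂} (Hom A B)]
  [homStrict : ∀ A B, Bicategory.Strict (Hom A B)]
  /-- the identity 1-cell -/
  one : ∀ A, Hom A A
  /-- composition of 1-cells, `comp G F = G F` -/
  comp : ∀ {A B C}, Hom B C → Hom A B → Hom A C
  /-- the 2-cell `G α` -/
  wl : ∀ {A B C} (G : Hom B C) {F F' : Hom A B}, (F ⟶ F') → (comp G F ⟶ comp G F')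
  /-- the 3-cell `G s` -/
  wl₃ : ∀ {A B C} (G : Hom B C) {F F' : Hom A B} {α α' : F ⟶ F'},
    (α ⟶ α') → (wl G α ⟶ wl G α')
  /-- the 2-cell `β F` -/
  wr : ∀ {A B C} {G G' : Hom B C}, (G ⟶ G') → ∀ F : Hom A B, comp G F ⟶ comp G' F
  /-- the 3-cell `t F` -/
  wr₃ : ∀ {A B C} {G G' : Hom B C} {β β' : G ⟶ G'},
    (β ⟶ β') → ∀ F : Hom A B, wr β F ⟶ wr β' F
  /-- the invertible 3-cell `β_α` -/
  interchange : ∀ {A B C} {G G' : Hom B C} (β : G ⟶ G') {F F' : Hom A B} (α : F ⟶ F'),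
    wr β F ≫ wl G' α ≅ wl G α ≫ wr β F'
  -- `G (-)` is a strict 2-functor
  wl_id : ∀ {A B C} (G : Hom B C) (F : Hom A B), wl G (𝟙 F) = 𝟙 (comp G F)
  wl_comp : ∀ {A B C} (G : Hom B C) {F F' F'' : Hom A B} (α : F ⟶ F') (γ : F' ⟶ F''),
    wl G (α ≫ γ) = wl G α ≫ wl G γ
  wl₃_id : ∀ {A B C} (G : Hom B C) {F F' : Hom A B} (α : F ⟶ F'), wl₃ G (𝟙 α) = 𝟙 (wl G α)
  wl₃_comp : ∀ {A B C} (G : Hom B C) {F F' : Hom A B} {α α' α'' : F ⟶ F'}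
    (s : α ⟶ α') (s' : α' ⟶ α''), wl₃ G (s ≫ s') = wl₃ G s ≫ wl₃ G s'
  wl₃_whiskerLeft : ∀ {A B C} (G : Hom B C) {F F' F'' : Hom A B} (α : F ⟶ F')
    {γ γ' : F' ⟶ F''} (s : γ ⟶ γ'), HEq (wl₃ G (α ◁ s)) (wl G α ◁ wl₃ G s)
  wl₃_whiskerRight : ∀ {A B C} (G : Hom B C) {F F' F'' : Hom A B} {α α' : F ⟶ F'}
    (s : α ⟶ α') (γ : F' ⟶ F''), HEq (wl₃ G (s ▷ γ)) (wl₃ G s ▷ wl G γ)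
  -- `(-) F` is a strict 2-functor
  wr_id : ∀ {A B C} (G : Hom B C) (F : Hom A B), wr (𝟙 G) F = 𝟙 (comp G F)
  wr_comp : ∀ {A B C} {G G' G'' : Hom B C} (β : G ⟶ G') (δ : G' ⟶ G'') (F : Hom A B),
    wr (β ≫ δ) F = wr β F ≫ wr δ F
  wr₃_id : ∀ {A B C} {G G' : Hom B C} (β : G ⟶ G') (F : Hom A B), wr₃ (𝟙 β) F = 𝟙 (wr β F)
  wr₃_comp : ∀ {A B C} {G G' : Hom B C} {β β' β'' : G ⟶ G'}
    (t : β ⟶ β') (t' : β' ⟶ β'') (F : Hom A B), wr₃ (t ≫ t') F = wr₃ t F ≫ wr₃ t' F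
  wr₃_whiskerLeft : ∀ {A B C} {G G' G'' : Hom B C} (β : G ⟶ G') {δ δ' : G' ⟶ G''}
    (t : δ ⟶ δ') (F : Hom A B), HEq (wr₃ (β ◁ t) F) (wr β F ◁ wr₃ t F)
  wr₃_whiskerRight : ∀ {A B C} {G G' G'' : Hom B C} {β β' : G ⟶ G'} (t : β ⟶ β')
    (δ : G' ⟶ G'') (F : Hom A B), HEq (wr₃ (t ▷ δ) F) (wr₃ t F ▷ wr δ F)
  -- the axioms of a cubical functor: `β_{γ α}` and `(δ β)_α` are pasted from the interchange cells
  -- of the factors, and interchange is natural in both variables (the normalization `β_1 = 1`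
  -- and `1_α = 1` follows from the first two, as the interchange cells are invertible)
  interchange_comp_right : ∀ {A B C} {G G' : Hom B C} (β : G ⟶ G') {F F' F'' : Hom A B}
    (α : F ⟶ F') (γ : F' ⟶ F''),
    HEq (interchange β (α ≫ γ)).hom
      ((α_ (wr β F) (wl G' α) (wl G' γ)).inv ≫ (interchange β α).hom ▷ wl G' γ ≫
        (α_ (wl G α) (wr β F') (wl G' γ)).hom ≫ wl G α ◁ (interchange β γ).hom ≫
        (α_ (wl G α) (wl G γ) (wr β F'')).inv)
  interchange_comp_left : ∀ {A B C} {G G' G'' : Hom B C} (β : G ⟶ G') (δ : G' ⟶ G'')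
    {F F' : Hom A B} (α : F ⟶ F'),
    HEq (interchange (β ≫ δ) α).hom
      ((α_ (wr β F) (wr δ F) (wl G'' α)).hom ≫ wr β F ◁ (interchange δ α).hom ≫
        (α_ (wr β F) (wl G' α) (wr δ F')).inv ≫ (interchange β α).hom ▷ wr δ F' ≫
        (α_ (wl G α) (wr β F') (wr δ F')).hom)
  interchange_natural_right : ∀ {A B C} {G G' : Hom B C} (β : G ⟶ G') {F F' : Hom A B}
    {α' α : F ⟶ F'} (s : α' ⟶ α),
    wr β F ◁ wl₃ G' s ≫ (interchange β α).hom = (interchange β α').hom ≫ wl₃ G s ▷ wr β F'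
  interchange_natural_left : ∀ {A B C} {G G' : Hom B C} {β' β : G ⟶ G'} (t : β' ⟶ β)
    {F F' : Hom A B} (α : F ⟶ F'),
    wr₃ t F ▷ wl G' α ≫ (interchange β α).hom = (interchange β' α).hom ≫ wl G α ◁ wr₃ t F'
  -- associativity, on 1-cells, 2-cells, 3-cells and interchange cells
  assoc : ∀ {A B C D} (H : Hom C D) (G : Hom B C) (F : Hom A B),
    comp (comp H G) F = comp H (comp G F)
  wl_wl : ∀ {A B C D} (H : Hom C D) (G : Hom B C) {F F' : Hom A B} (α : F ⟶ F'),
    HEq (wl H (wl G α)) (wl (comp H G) α)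
  wl_wr : ∀ {A B C D} (H : Hom C D) {G G' : Hom B C} (β : G ⟶ G') (F : Hom A B),
    HEq (wl H (wr β F)) (wr (wl H β) F)
  wr_wr : ∀ {A B C D} {H H' : Hom C D} (γ : H ⟶ H') (G : Hom B C) (F : Hom A B),
    HEq (wr (wr γ G) F) (wr γ (comp G F))
  wl₃_wl₃ : ∀ {A B C D} (H : Hom C D) (G : Hom B C) {F F' : Hom A B} {α α' : F ⟶ F'}
    (s : α ⟶ α'), HEq (wl₃ H (wl₃ G s)) (wl₃ (comp H G) s)
  wl₃_wr₃ : ∀ {A B C D} (H : Hom C D) {G G' : Hom B C} {β β' : G ⟶ G'} (t : β ⟶ β')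
    (F : Hom A B), HEq (wl₃ H (wr₃ t F)) (wr₃ (wl₃ H t) F)
  wr₃_wr₃ : ∀ {A B C D} {H H' : Hom C D} {γ γ' : H ⟶ H'} (r : γ ⟶ γ') (G : Hom B C)
    (F : Hom A B), HEq (wr₃ (wr₃ r G) F) (wr₃ r (comp G F))
  interchange_wr : ∀ {A B C D} {H H' : Hom C D} (γ : H ⟶ H') {G G' : Hom B C} (β : G ⟶ G')
    (F : Hom A B), HEq (interchange γ (wr β F)).hom (wr₃ (interchange γ β).hom F)
  interchange_mid : ∀ {A B C D} {H H' : Hom C D} (γ : H ⟶ H') (G : Hom B C) {F F' : Hom A B}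
    (α : F ⟶ F'), HEq (interchange γ (wl G α)).hom (interchange (wr γ G) α).hom
  interchange_wl : ∀ {A B C D} (H : Hom C D) {G G' : Hom B C} (β : G ⟶ G') {F F' : Hom A B}
    (α : F ⟶ F'), HEq (wl₃ H (interchange β α).hom) (interchange (wl H β) α).hom
  -- unit laws
  one_comp : ∀ {A B} (F : Hom A B), comp (one B) F = F
  comp_one : ∀ {A B} (F : Hom A B), comp F (one A) = F
  one_wl : ∀ {A B} {F F' : Hom A B} (α : F ⟶ F'), HEq (wl (one B) α) α
  wr_one : ∀ {A B} {F F' : Hom A B} (α : F ⟶ F'), HEq (wr α (one A)) α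
  one_wl₃ : ∀ {A B} {F F' : Hom A B} {α α' : F ⟶ F'} (s : α ⟶ α'), HEq (wl₃ (one B) s) s
  wr₃_one : ∀ {A B} {F F' : Hom A B} {α α' : F ⟶ F'} (s : α ⟶ α'), HEq (wr₃ s (one A)) s

namespace GrayCategory

attribute [instance] GrayCategory.homBicategory GrayCategory.homStrict

section Strict

variable {B : Type v₁} [Bicategory.{w, v₂} B]

theorem heq_inv {F F' G G' : B} (hF : F = F') (hG : G = G') {a b : F ⟶ G} {a' b' : F' ⟶ G'}
    (ha : HEq a a') (hb : HEq b b') {e : a ≅ b} {e' : a' ≅ b'} (h : HEq e.hom e'.hom) :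
    HEq e.inv e'.inv := by
  subst hF hG
  obtain rfl := eq_of_heq ha
  obtain rfl := eq_of_heq hb
  obtain rfl : e = e' := Iso.ext (eq_of_heq h)
  rfl

theorem heq_comp {X X' Y Y' Z Z' : B} (hX : X = X') (hY : Y = Y') (hZ : Z = Z')
    {a : X ⟶ Y} {a' : X' ⟶ Y'} {b : Y ⟶ Z} {b' : Y' ⟶ Z'} (ha : HEq a a') (hb : HEq b b') :
    HEq (a ≫ b) (a' ≫ b') := by
  subst hX hY hZ
  obtain rfl := eq_of_heq ha
  obtain rfl := eq_of_heq hb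
  rfl

variable [Bicategory.Strict B]

theorem eq_cast_of_heq {X X' Y Y' : B} (hX : X = X') (hY : Y = Y') {a : X ⟶ Y} {a' : X' ⟶ Y'}
    (h : HEq a a') : a = eqToHom hX ≫ a' ≫ eqToHom hY.symm := by
  subst hX hY
  obtain rfl := eq_of_heq h
  simp

end Strict

variable (K : GrayCategory.{w, v₂, v₁, u})

theorem wl_eqToHom {A B C : K.Obj} (G : K.Hom B C) {F F' : K.Hom A B} (h : F = F') :
    K.wl G (eqToHom h) = eqToHom (congrArg (K.comp G) h) := by
  subst h
  simp [K.wl_id]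

theorem wr_eqToHom {A B C : K.Obj} {G G' : K.Hom B C} (h : G = G') (F : K.Hom A B) :
    K.wr (eqToHom h) F = eqToHom (congrArg (fun T => K.comp T F) h) := by
  subst h
  simp [K.wr_id]

/-- `G (-)` on invertible 3-cells. -/
def wlIso {A B C : K.Obj} (G : K.Hom B C) {F F' : K.Hom A B} {α α' : F ⟶ F'} (s : α ≅ α') :
    K.wl G α ≅ K.wl G α' where
  hom := K.wl₃ G s.hom
  inv := K.wl₃ G s.inv
  hom_inv_id := by rw [← K.wl₃_comp, s.hom_inv_id, K.wl₃_id]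
  inv_hom_id := by rw [← K.wl₃_comp, s.inv_hom_id, K.wl₃_id]

/-- `(-) F` on invertible 3-cells. -/
def wrIso {A B C : K.Obj} {G G' : K.Hom B C} {β β' : G ⟶ G'} (t : β ≅ β') (F : K.Hom A B) :
    K.wr β F ≅ K.wr β' F where
  hom := K.wr₃ t.hom F
  inv := K.wr₃ t.inv F
  hom_inv_id := by rw [← K.wr₃_comp, t.hom_inv_id, K.wr₃_id]
  inv_hom_id := by rw [← K.wr₃_comp, t.inv_hom_id, K.wr₃_id]

/-- The horizontal dual: 1-cells are reversed, 2-cells and 3-cells are not. The roles of the two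
whiskerings are swapped, and the interchange cells are replaced by their inverses. -/
abbrev op : GrayCategory.{w, v₂, v₁, u} where
  Obj := K.Obj
  Hom A B := K.Hom B A
  homBicategory A B := K.homBicategory B A
  homStrict A B := K.homStrict B A
  one A := K.one A
  comp G F := K.comp F G
  wl G _ _ α := K.wr α G
  wl₃ G _ _ _ _ s := K.wr₃ s G
  wr β F := K.wl F β
  wr₃ t F := K.wl₃ F t
  interchange β _ _ α := (K.interchange α β).symm
  wl_id G F := K.wr_id F G
  wl_comp G _ _ _ α γ := K.wr_comp α γ G
  wl₃_id G _ _ α := K.wr₃_id α G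
  wl₃_comp G _ _ _ _ _ s s' := K.wr₃_comp s s' G
  wl₃_whiskerLeft G _ _ _ α _ _ s := K.wr₃_whiskerLeft α s G
  wl₃_whiskerRight G _ _ _ _ _ s γ := K.wr₃_whiskerRight s γ G
  wr_id G F := K.wl_id F G
  wr_comp β δ F := K.wl_comp F β δ
  wr₃_id β F := K.wl₃_id F β
  wr₃_comp t t' F := K.wl₃_comp F t t'
  wr₃_whiskerLeft β _ _ t F := K.wl₃_whiskerLeft F β t
  wr₃_whiskerRight t δ F := K.wl₃_whiskerRight F t δ
  interchange_comp_right {A B C G G'} β {F F' F''} α γ := by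
    let e : K.wl F β ≫ K.wr α G' ≫ K.wr γ G' ≅ (K.wr α G ≫ K.wr γ G) ≫ K.wl F'' β :=
      (α_ _ _ _).symm ≪≫ whiskerRightIso (K.interchange α β).symm (K.wr γ G') ≪≫ α_ _ _ _ ≪≫
        whiskerLeftIso (K.wr α G) (K.interchange γ β).symm ≪≫ (α_ _ _ _).symm
    have h : HEq (K.interchange (α ≫ γ) β).hom e.symm.hom := by
      simpa [e] using K.interchange_comp_left α γ β
    exact heq_inv rfl rfl (by rw [K.wr_comp]) (by rw [K.wr_comp]) h
  interchange_comp_left {A B C G G' G''} β δ {F F'} α := by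
    let e : (K.wl F β ≫ K.wl F δ) ≫ K.wr α G'' ≅ K.wr α G ≫ K.wl F' β ≫ K.wl F' δ :=
      α_ _ _ _ ≪≫ whiskerLeftIso (K.wl F β) (K.interchange α δ).symm ≪≫ (α_ _ _ _).symm ≪≫
        whiskerRightIso (K.interchange α β).symm (K.wl F' δ) ≪≫ α_ _ _ _
    have h : HEq (K.interchange α (β ≫ δ)).hom e.symm.hom := by
      simpa [e] using K.interchange_comp_right α β δ
    exact heq_inv rfl rfl (by rw [K.wl_comp]) (by rw [K.wl_comp]) h
  interchange_natural_right {A B C G G'} β {F F' α' α} s := by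
    have h := K.interchange_natural_left s β
    simp only [Iso.symm_hom]
    rw [Iso.comp_inv_eq, Category.assoc, h, Iso.inv_hom_id_assoc]
  interchange_natural_left {A B C G G' β' β} t {F F'} α := by
    have h := K.interchange_natural_right α t
    simp only [Iso.symm_hom]
    rw [Iso.comp_inv_eq, Category.assoc, h, Iso.inv_hom_id_assoc]
  assoc H G F := (K.assoc F G H).symm
  wl_wl H G _ _ α := K.wr_wr α G H
  wl_wr H _ _ β F := (K.wl_wr F β H).symm
  wr_wr γ G F := K.wl_wl F G γ
  wl₃_wl₃ H G _ _ _ _ s := K.wr₃_wr₃ s G H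
  wl₃_wr₃ H _ _ _ _ t F := (K.wl₃_wr₃ F t H).symm
  wr₃_wr₃ r G F := K.wl₃_wl₃ F G r
  interchange_wr {A B C D H H'} γ {G G'} β F := by
    refine heq_inv (K.assoc F G H) (K.assoc F G' H') ?_ ?_
      (e' := K.wlIso F (K.interchange β γ)) (K.interchange_wl F β γ).symm
    · rw [K.wl_comp]
      exact heq_comp (K.assoc ..) (K.assoc ..) (K.assoc ..) (K.wl_wr ..).symm (K.wl_wl ..).symm
    · rw [K.wl_comp]
      exact heq_comp (K.assoc ..) (K.assoc ..) (K.assoc ..) (K.wl_wl ..).symm (K.wl_wr ..).symm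
  interchange_mid {A B C D H H'} γ G {F F'} α := by
    refine heq_inv (K.assoc F G H) (K.assoc F' G H') ?_ ?_ (K.interchange_mid α G γ).symm
    · exact heq_comp (K.assoc ..) (K.assoc ..) (K.assoc ..) (K.wr_wr ..) (K.wl_wl ..).symm
    · exact heq_comp (K.assoc ..) (K.assoc ..) (K.assoc ..) (K.wl_wl ..).symm (K.wr_wr ..)
  interchange_wl {A B C D} H {G G'} β {F F'} α := by
    refine heq_inv (e := K.wrIso (K.interchange α β) H) (K.assoc F G H) (K.assoc F' G' H) ?_ ?_
      (K.interchange_wr α β H).symm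
    · rw [K.wr_comp]
      exact heq_comp (K.assoc ..) (K.assoc ..) (K.assoc ..) (K.wr_wr ..) (K.wl_wr ..).symm
    · rw [K.wr_comp]
      exact heq_comp (K.assoc ..) (K.assoc ..) (K.assoc ..) (K.wl_wr ..).symm (K.wr_wr ..)
  one_comp F := K.comp_one F
  comp_one F := K.one_comp F
  one_wl α := K.wr_one α
  wr_one α := K.one_wl α
  one_wl₃ s := K.wr₃_one s
  wr₃_one s := K.one_wl₃ s

section Pseudoadjunction

variable {K} {X A : K.Obj} {F : K.Hom X A} {U : K.Hom A X}

/-- The composite `F ⟶ F U F ⟶ F` of `F η` and `ϵ F`. -/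
def triangleLeft (η : K.one X ⟶ K.comp U F) (ϵ : K.comp F U ⟶ K.one A) : F ⟶ F :=
  eqToHom (K.comp_one F).symm ≫ K.wl F η ≫ eqToHom (K.assoc F U F).symm ≫ K.wr ϵ F ≫
    eqToHom (K.one_comp F)

/-- The composite `U ⟶ U F U ⟶ U` of `η U` and `U ϵ`. -/
def triangleRight (η : K.one X ⟶ K.comp U F) (ϵ : K.comp F U ⟶ K.one A) : U ⟶ U :=
  eqToHom (K.one_comp U).symm ≫ K.wr η U ≫ eqToHom (K.assoc U F U) ≫ K.wl U ϵ ≫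
    eqToHom (K.comp_one U)

/-- The 2-cell `U ϵ F : (U F) (U F) ⟶ U F`. -/
def counitMid (ϵ : K.comp F U ⟶ K.one A) (U' : K.Hom A X) (F' : K.Hom X A) :
    K.comp (K.comp U' F) (K.comp U F') ⟶ K.comp U' F' :=
  eqToHom ((K.assoc U' F (K.comp U F')).trans
      (congrArg (K.comp U') (K.assoc F U F').symm)) ≫
    K.wl U' (K.wr ϵ F') ≫ eqToHom (congrArg (K.comp U') (K.one_comp F'))

/-- The 2-cell `F η U : F U ⟶ (F U) (F U)`. -/
def unitMid (η : K.one X ⟶ K.comp U F) (F' : K.Hom X A) (U' : K.Hom A X) :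
    K.comp F' U' ⟶ K.comp (K.comp F' U) (K.comp F U') :=
  eqToHom (congrArg (K.comp F') (K.one_comp U').symm) ≫ K.wl F' (K.wr η U') ≫
    eqToHom ((congrArg (K.comp F') (K.assoc U F U')).trans (K.assoc F' U (K.comp F U')).symm)

variable (η : K.one X ⟶ K.comp U F) (ϵ : K.comp F U ⟶ K.one A)

/-- `U (ϵ F ∘ F η) ∘ η = U ϵ F ∘ (U F η ∘ η)` -/
theorem unit_comp_wl_triangleLeft :
    η ≫ K.wl U (triangleLeft η ϵ) =
      (eqToHom (K.comp_one (K.one X)).symm ≫ (K.wr η (K.one X) ≫ K.wl (K.comp U F) η)) ≫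
        counitMid ϵ U F := by
  have h₁ := eq_cast_of_heq (K.comp_one _) (K.comp_one _) (K.wr_one η)
  have h₂ := eq_cast_of_heq (K.assoc U F _).symm (K.assoc U F _).symm (K.wl_wl U F η)
  simp [triangleLeft, counitMid, K.wl_comp, wl_eqToHom, h₁, h₂]

/-- `U ϵ F ∘ (η U F ∘ η) = (U ϵ ∘ η U) F ∘ η` -/
theorem unit_comp_wr_triangleRight :
    (eqToHom (K.comp_one (K.one X)).symm ≫ (K.wl (K.one X) η ≫ K.wr η (K.comp U F))) ≫
        counitMid ϵ U F = η ≫ K.wr (triangleRight η ϵ) F := by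
  have h₁ := eq_cast_of_heq (K.one_comp _) (K.one_comp _) (K.one_wl η)
  have h₂ := eq_cast_of_heq (K.assoc _ U F) (K.assoc _ U F) (K.wr_wr η U F)
  have h₃ := eq_cast_of_heq (K.assoc U _ F).symm (K.assoc U _ F).symm (K.wl_wr U ϵ F)
  simp [triangleRight, counitMid, K.wr_comp, wr_eqToHom, h₁, h₂, h₃]

/-- `ϵ ∘ (ϵ F ∘ F η) U = (ϵ ∘ ϵ F U) ∘ F η U` -/
theorem wr_triangleLeft_comp_counit :
    K.wr (triangleLeft η ϵ) U ≫ ϵ =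
      unitMid η F U ≫ (K.wr ϵ (K.comp F U) ≫ K.wl (K.one A) ϵ) ≫
        eqToHom (K.comp_one (K.one A)) := by
  have h₁ := eq_cast_of_heq (K.one_comp _) (K.one_comp _) (K.one_wl ϵ)
  have h₂ := eq_cast_of_heq (K.assoc _ F U) (K.assoc _ F U) (K.wr_wr ϵ F U)
  have h₃ := eq_cast_of_heq (K.assoc F _ U).symm (K.assoc F _ U).symm (K.wl_wr F η U)
  simp [triangleLeft, unitMid, K.wr_comp, wr_eqToHom, h₁, h₂, h₃]

/-- `(ϵ ∘ F U ϵ) ∘ F η U = ϵ ∘ F (U ϵ ∘ η U)` -/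
theorem wl_triangleRight_comp_counit :
    unitMid η F U ≫ (K.wl (K.comp F U) ϵ ≫ K.wr ϵ (K.one A)) ≫ eqToHom (K.comp_one (K.one A)) =
      K.wl F (triangleRight η ϵ) ≫ ϵ := by
  have h₁ := eq_cast_of_heq (K.comp_one _) (K.comp_one _) (K.wr_one ϵ)
  have h₂ := eq_cast_of_heq (K.assoc F U _).symm (K.assoc F U _).symm (K.wl_wl F U ϵ)
  simp [triangleRight, unitMid, K.wl_comp, wl_eqToHom, h₁, h₂]

/-- The pasting of `U s`, the interchange cell `η_η` and `t F`, a 3-cell `η ⟶ η`. The `eqToHom`s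
are the identities relating the different bracketings of the boundaries. -/
def unitPasting (s : 𝟙 F ⟶ triangleLeft η ϵ) (t : triangleRight η ϵ ⟶ 𝟙 U) : η ⟶ η :=
  eqToHom (by simp [K.wl_id]) ≫
    η ◁ K.wl₃ U s ≫
    eqToHom (unit_comp_wl_triangleLeft η ϵ) ≫
    (eqToHom (K.comp_one (K.one X)).symm ◁ (K.interchange η η).hom) ▷ counitMid ϵ U F ≫
    eqToHom (unit_comp_wr_triangleRight η ϵ) ≫
    η ◁ K.wr₃ t F ≫
    eqToHom (by simp [K.wr_id])

/-- The pasting of `s U`, the interchange cell `ϵ_ϵ` and `F t`, a 3-cell `ϵ ⟶ ϵ`. -/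
def counitPasting (s : 𝟙 F ⟶ triangleLeft η ϵ) (t : triangleRight η ϵ ⟶ 𝟙 U) : ϵ ⟶ ϵ :=
  eqToHom (by simp [K.wr_id]) ≫
    K.wr₃ s U ▷ ϵ ≫
    eqToHom (wr_triangleLeft_comp_counit η ϵ) ≫
    unitMid η F U ◁ (K.interchange ϵ ϵ).hom ▷ eqToHom (K.comp_one (K.one A)) ≫
    eqToHom (wl_triangleRight_comp_counit η ϵ) ≫
    K.wl₃ F t ▷ ϵ ≫
    eqToHom (by simp [K.wl_id])

variable (F U)

/-- A pseudoadjunction `F ⊣ U`: a unit `η : 1 ⟶ U F`, a counit `ϵ : F U ⟶ 1`, and invertible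
3-cells `s : 1_F ⇛ ϵ F ∘ F η` and `t : U ϵ ∘ η U ⇛ 1_U`, subject to two coherence identities. -/
structure Pseudoadjunction where
  unit : K.one X ⟶ K.comp U F
  counit : K.comp F U ⟶ K.one A
  s : 𝟙 F ≅ triangleLeft unit counit
  t : triangleRight unit counit ≅ 𝟙 U
  unit_coherence : unitPasting unit counit s.hom t.hom = 𝟙 unit
  counit_coherence : counitPasting unit counit s.hom t.hom = 𝟙 counit

end Pseudoadjunction

section Pseudoextension

variable {X A B : K.Obj}

/-- `η : H ⟶ L J` exhibits `L` as a left pseudoextension of `H` along `J`: every `f : H ⟶ Q J`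
has an `f' : L ⟶ Q` and an invertible 3-cell `μ : f' J ∘ η ⇛ f` such that each 3-cell
`ω : k J ∘ η ⇛ f` is `μ` pasted with `ω' J` for a unique `ω' : k ⇛ f'`, and `ω'` is invertible
as soon as `ω` is. Equivalently, `k ↦ k J ∘ η` is an equivalence of categories
`(L ⟶ Q) ≌ (H ⟶ Q J)` for every `Q`. -/
def IsLeftPseudoextension (J : K.Hom X A) (H : K.Hom X B) (L : K.Hom A B)
    (η : H ⟶ K.comp L J) : Prop :=
  ∀ (Q : K.Hom A B) (f : H ⟶ K.comp Q J),
    ∃ (f' : L ⟶ Q) (μ : η ≫ K.wr f' J ≅ f),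
      ∀ (k : L ⟶ Q) (ω : η ≫ K.wr k J ⟶ f),
        ∃ ω' : k ⟶ f', η ◁ K.wr₃ ω' J ≫ μ.hom = ω ∧
          (∀ ω'' : k ⟶ f', η ◁ K.wr₃ ω'' J ≫ μ.hom = ω → ω'' = ω') ∧
          (IsIso ω → IsIso ω')

/-- The pseudoextension `η` is preserved by `G`: the 2-cell `G η` exhibits `G L` as a left
pseudoextension of `G H` along `J`. -/
def PreservesLeftPseudoextension {C : K.Obj} (G : K.Hom B C) (J : K.Hom X A) (H : K.Hom X B)
    (L : K.Hom A B) (η : H ⟶ K.comp L J) : Prop :=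
  K.IsLeftPseudoextension J (K.comp G H) (K.comp G L) (K.wl G η ≫ eqToHom (K.assoc G L J).symm)

/-- `η` is a left pseudoextension that is preserved by every 1-cell. -/
def IsAbsoluteLeftPseudoextension (J : K.Hom X A) (H : K.Hom X B) (L : K.Hom A B)
    (η : H ⟶ K.comp L J) : Prop :=
  K.IsLeftPseudoextension J H L η ∧
    ∀ (C : K.Obj) (G : K.Hom B C), K.PreservesLeftPseudoextension G J H L η

/-- `η : H ⟶ J L` exhibits `L` as a left pseudolifting of `H` through `J`: it is a left
pseudoextension in the horizontal dual. -/
def IsLeftPseudolifting (J : K.Hom A X) (H : K.Hom B X) (L : K.Hom B A)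
    (η : H ⟶ K.comp J L) : Prop :=
  K.op.IsLeftPseudoextension J H L η

/-- The pseudolifting `η` is preserved by `G`: the 2-cell `η G` exhibits `L G` as a left
pseudolifting of `H G` through `J`. -/
def PreservesLeftPseudolifting {C : K.Obj} (G : K.Hom C B) (J : K.Hom A X) (H : K.Hom B X)
    (L : K.Hom B A) (η : H ⟶ K.comp J L) : Prop :=
  K.op.PreservesLeftPseudoextension G J H L η

/-- `η` is a left pseudolifting that is preserved by every 1-cell. -/
def IsAbsoluteLeftPseudolifting (J : K.Hom A X) (H : K.Hom B X) (L : K.Hom B A)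
    (η : H ⟶ K.comp J L) : Prop :=
  K.op.IsAbsoluteLeftPseudoextension J H L η

/-- The notion of a left pseudolifting, with the dual spelled out. -/
theorem isLeftPseudolifting_iff (J : K.Hom A X) (H : K.Hom B X) (L : K.Hom B A)
    (η : H ⟶ K.comp J L) :
    K.IsLeftPseudolifting J H L η ↔
      ∀ (Q : K.Hom B A) (f : H ⟶ K.comp J Q),
        ∃ (f' : L ⟶ Q) (μ : η ≫ K.wl J f' ≅ f),
          ∀ (k : L ⟶ Q) (ω : η ≫ K.wl J k ⟶ f),
            ∃ ω' : k ⟶ f', η ◁ K.wl₃ J ω' ≫ μ.hom = ω ∧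
              (∀ ω'' : k ⟶ f', η ◁ K.wl₃ J ω'' ≫ μ.hom = ω → ω'' = ω') ∧
              (IsIso ω → IsIso ω') :=
  Iff.rfl

/-- The preservation of a left pseudolifting, with the dual spelled out. -/
theorem preservesLeftPseudolifting_iff {C : K.Obj} (G : K.Hom C B) (J : K.Hom A X)
    (H : K.Hom B X) (L : K.Hom B A) (η : H ⟶ K.comp J L) :
    K.PreservesLeftPseudolifting G J H L η ↔
      K.IsLeftPseudolifting J (K.comp H G) (K.comp L G)
        (K.wr η G ≫ eqToHom (K.assoc J L G)) :=
  Iff.rfl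

end Pseudoextension

end GrayCategory

/-!
A 1-cell `F : X → A` and a 2-cell `η : 1 ⟶ U F` act on the hom-2-categories: for a 1-cell `G` out of
`X` there is `unitAt η G : G ⟶ (G U) F`, pseudonatural in `G` by interchange with `η` (`unitNat`),
and a 2-cell `ϵ : F U ⟶ 1` likewise gives `counitAt ϵ Q : (Q F) U ⟶ Q` with `counitNat`. Being a left
pseudoextension means that all functors `k ↦ k F ∘ η` (`restrict`) are equivalences
(`isLeftPseudoextension_iff_isEquivalence_restrict`).

A pseudoadjunction gives the absolute pseudoextension, since `f ↦ Q ϵ ∘ f U` is inverse to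
restriction along `G η`, by the interchange cells and the cells `G t` and `Q s`
(`isLeftPseudoextension_unitAt`).

Conversely, let `η` be a left pseudoextension preserved by `F`. Lifting the identity of `F` along
`F η` gives `ϵ` together with `s`, and as restriction along `η` is fully faithful there is exactly
one `t` for which the first coherence identity holds. For the second one, restriction along `F η` is
faithful, so it is enough to whisker with `F η`. There the identity follows from the first one,
the naturality of interchange with respect to `s` on both sides, and the equality
`s ▷ (F η ≫ ϵ F) = (F η ≫ ϵ F) ◁ s`, which holds as `s` is invertible. This last step is a computation
in a bicategory (`whiskerLeft_eq_of_triangle`).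

The statements on liftings are those on extensions in the horizontal dual, and a pseudoadjunction
`F ⊣ U` in `K` is a pseudoadjunction `U ⊣ F` in `K.op` (`Pseudoadjunction.op`).

Boundaries of cells often agree only up to the strict associativity and unit laws. Such equalities
are handled by bundling a cell with its boundary (`cell₂`, `cell₃`).
-/

namespace GrayCategory

/-! ### Cells up to equality of their boundaries -/

section Cells

variable {C : Type v₁} [Bicategory.{w, v₂} C]

/-- A 1-morphism together with its boundary. An equation `cell₂ a = cell₂ a'` says that the
2-cells `a` and `a'` of a Gray-category agree, where the boundaries need only be propositionally
equal. -/
def cell₂ {X Y : C} (a : X ⟶ Y) : Σ X Y : C, X ⟶ Y := ⟨X, Y, a⟩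

/-- A 2-morphism together with its boundary. An equation `cell₃ s = cell₃ s'` says that the
3-cells `s` and `s'` of a Gray-category agree, where the boundaries need only be propositionally
equal. Unlike heterogeneous equality it records that the boundaries agree, so that it is a
congruence for all operations. -/
def cell₃ {X Y : C} {a b : X ⟶ Y} (s : a ⟶ b) : Σ (X Y : C) (a b : X ⟶ Y), (a ⟶ b) :=
  ⟨X, Y, a, b, s⟩

theorem cell₂_injective {X Y : C} {a a' : X ⟶ Y} (h : cell₂ a = cell₂ a') : a = a' := by
  simpa [cell₂] using h

theorem cell₃_injective {X Y : C} {a b : X ⟶ Y} {s s' : a ⟶ b} (h : cell₃ s = cell₃ s') :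
    s = s' := by
  simpa [cell₃] using h

theorem cell₂_of_heq {X X' Y Y' : C} (hX : X = X') (hY : Y = Y') {a : X ⟶ Y} {a' : X' ⟶ Y'}
    (h : HEq a a') : cell₂ a = cell₂ a' := by
  subst hX hY
  obtain rfl := eq_of_heq h
  rfl

theorem cell₃_of_heq {X X' Y Y' : C} {a b : X ⟶ Y} {a' b' : X' ⟶ Y'} (ha : cell₂ a = cell₂ a')
    (hb : cell₂ b = cell₂ b') {s : a ⟶ b} {s' : a' ⟶ b'} (h : HEq s s') :
    cell₃ s = cell₃ s' := by
  cases ha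
  cases hb
  cases h
  rfl

theorem cell₂_comp {X Y Z X' Y' Z' : C} {a : X ⟶ Y} {b : Y ⟶ Z} {a' : X' ⟶ Y'} {b' : Y' ⟶ Z'}
    (ha : cell₂ a = cell₂ a') (hb : cell₂ b = cell₂ b') : cell₂ (a ≫ b) = cell₂ (a' ≫ b') := by
  cases ha
  cases hb
  rfl

theorem cell₃_comp {X Y X' Y' : C} {a b c : X ⟶ Y} {s : a ⟶ b} {t : b ⟶ c} {a' b' c' : X' ⟶ Y'}
    {s' : a' ⟶ b'} {t' : b' ⟶ c'} (hs : cell₃ s = cell₃ s') (ht : cell₃ t = cell₃ t') :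
    cell₃ (s ≫ t) = cell₃ (s' ≫ t') := by
  cases hs
  cases ht
  rfl

theorem cell₃_whiskerLeft {X Y Z X' Y' Z' : C} {f : X ⟶ Y} {a b : Y ⟶ Z} {s : a ⟶ b}
    {f' : X' ⟶ Y'} {a' b' : Y' ⟶ Z'} {s' : a' ⟶ b'} (hf : cell₂ f = cell₂ f')
    (hs : cell₃ s = cell₃ s') : cell₃ (f ◁ s) = cell₃ (f' ◁ s') := by
  cases hf
  cases hs
  rfl

theorem cell₃_whiskerRight {X Y Z X' Y' Z' : C} {a b : X ⟶ Y} {s : a ⟶ b} {f : Y ⟶ Z}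
    {a' b' : X' ⟶ Y'} {s' : a' ⟶ b'} {f' : Y' ⟶ Z'} (hs : cell₃ s = cell₃ s')
    (hf : cell₂ f = cell₂ f') : cell₃ (s ▷ f) = cell₃ (s' ▷ f') := by
  cases hf
  cases hs
  rfl

theorem cell₃_id {X Y X' Y' : C} {a : X ⟶ Y} {a' : X' ⟶ Y'} (h : cell₂ a = cell₂ a') :
    cell₃ (𝟙 a) = cell₃ (𝟙 a') := by
  cases h
  rfl

@[simp]
theorem cell₃_eqToHom_comp {X Y : C} {a b c : X ⟶ Y} (h : a = b) (s : b ⟶ c) :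
    cell₃ (eqToHom h ≫ s) = cell₃ s := by
  subst h
  simp

@[simp]
theorem cell₃_comp_eqToHom {X Y : C} {a b c : X ⟶ Y} (s : a ⟶ b) (h : b = c) :
    cell₃ (s ≫ eqToHom h) = cell₃ s := by
  subst h
  simp

/-- Change of the boundary of an invertible 3-cell along equalities of cells. -/
def castIso {Y Z Y' Z' : C} {a b : Y ⟶ Z} {a' b' : Y' ⟶ Z'}
    (e : a' ≅ b') (ha : cell₂ a = cell₂ a') (hb : cell₂ b = cell₂ b') : a ≅ b := by
  cases ha
  exact e ≪≫ eqToIso (cell₂_injective hb.symm)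

theorem cell₃_castIso_hom {Y Z Y' Z' : C} {a b : Y ⟶ Z}
    {a' b' : Y' ⟶ Z'} (e : a' ≅ b') (ha : cell₂ a = cell₂ a') (hb : cell₂ b = cell₂ b') :
    cell₃ (castIso e ha hb).hom = cell₃ e.hom := by
  cases ha
  simp [castIso]

theorem cell₃_comp_of_left_id {X Y X' Y' : C}
    {a b c : X ⟶ Y} {d : X' ⟶ Y'} {s : a ⟶ b} (h : cell₃ s = cell₃ (𝟙 d)) (t : b ⟶ c) :
    cell₃ (s ≫ t) = cell₃ t := by
  cases h
  rw [Category.id_comp]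

/-- An invertible 3-cell that is idempotent, up to equality of its boundaries with `d`, is the
identity of `d`. -/
theorem cell₃_eq_id_of_idem {X Y X' Y' : C}
    {a b : X ⟶ Y} {d : X' ⟶ Y'} (e : a ≅ b) (ha : cell₂ d = cell₂ a) (hb : cell₂ d = cell₂ b)
    (h : ∀ e' : d ≅ d, cell₃ e'.hom = cell₃ e.hom → cell₃ e.hom = cell₃ (e'.hom ≫ e'.hom)) :
    cell₃ e.hom = cell₃ (𝟙 d) := by
  have he := cell₃_castIso_hom e ha hb
  have h' := cell₃_injective (he.trans (h _ he))
  rw [← he]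
  congr 1
  rw [← cancel_epi (castIso e ha hb).hom, ← h', Category.comp_id]

variable [Bicategory.Strict C]

@[simp]
theorem cell₂_eqToHom_comp {X Y Z : C} (h : X = Y) (a : Y ⟶ Z) :
    cell₂ (eqToHom h ≫ a) = cell₂ a := by
  subst h
  simp

@[simp]
theorem cell₂_comp_eqToHom {X Y Z : C} (a : X ⟶ Y) (h : Y = Z) :
    cell₂ (a ≫ eqToHom h) = cell₂ a := by
  subst h
  simp

@[simp]
theorem cell₃_eqToHom_whiskerLeft {X Y Z : C} (h : X = Y) {a b : Y ⟶ Z} (s : a ⟶ b) :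
    cell₃ (eqToHom h ◁ s) = cell₃ s := by
  subst h
  simp [Strict.leftUnitor_eqToIso]

@[simp]
theorem cell₃_whiskerRight_eqToHom {X Y Z : C} {a b : X ⟶ Y} (s : a ⟶ b) (h : Y = Z) :
    cell₃ (s ▷ eqToHom h) = cell₃ s := by
  subst h
  simp [Strict.rightUnitor_eqToIso]

theorem cell₃_whisker_assoc {X Y Z W : C} (f : X ⟶ Y) {a b : Y ⟶ Z} (s : a ⟶ b) (g : Z ⟶ W) :
    cell₃ ((f ◁ s) ▷ g) = cell₃ (f ◁ (s ▷ g)) := by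
  simp [Strict.associator_eqToIso]

theorem cell₃_associator_comp {X Y Z W : C} (f : X ⟶ Y) (g : Y ⟶ Z) (h : Z ⟶ W) {a : X ⟶ W}
    (s : f ≫ g ≫ h ⟶ a) : cell₃ ((α_ f g h).hom ≫ s) = cell₃ s := by
  simp [Strict.associator_eqToIso]

theorem cell₃_associator_inv_comp {X Y Z W : C} (f : X ⟶ Y) (g : Y ⟶ Z) (h : Z ⟶ W) {a : X ⟶ W}
    (s : (f ≫ g) ≫ h ⟶ a) : cell₃ ((α_ f g h).inv ≫ s) = cell₃ s := by
  simp [Strict.associator_eqToIso]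

theorem cell₃_comp_associator {X Y Z W : C} (f : X ⟶ Y) (g : Y ⟶ Z) (h : Z ⟶ W) {a : X ⟶ W}
    (s : a ⟶ (f ≫ g) ≫ h) : cell₃ (s ≫ (α_ f g h).hom) = cell₃ s := by
  simp [Strict.associator_eqToIso]

theorem cell₃_comp_associator_inv {X Y Z W : C} (f : X ⟶ Y) (g : Y ⟶ Z) (h : Z ⟶ W) {a : X ⟶ W}
    (s : a ⟶ f ≫ g ≫ h) : cell₃ (s ≫ (α_ f g h).inv) = cell₃ s := by
  simp [Strict.associator_eqToIso]

end Cells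

/-! ### The Gray-category axioms as equations of cells -/

section GrayCells

variable (K : GrayCategory.{w, v₂, v₁, u}) {A B C D : K.Obj}

theorem cell₂_wl (G : K.Hom B C) {F₁ F₁' F₂ F₂' : K.Hom A B} {α₁ : F₁ ⟶ F₁'} {α₂ : F₂ ⟶ F₂'}
    (h : cell₂ α₁ = cell₂ α₂) : cell₂ (K.wl G α₁) = cell₂ (K.wl G α₂) := by
  cases h
  rfl

theorem cell₂_wr {G₁ G₁' G₂ G₂' : K.Hom B C} {β₁ : G₁ ⟶ G₁'} {β₂ : G₂ ⟶ G₂'}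
    (h : cell₂ β₁ = cell₂ β₂) (F : K.Hom A B) : cell₂ (K.wr β₁ F) = cell₂ (K.wr β₂ F) := by
  cases h
  rfl

theorem cell₃_wl₃ (G : K.Hom B C) {F₁ F₁' F₂ F₂' : K.Hom A B} {α₁ α₁' : F₁ ⟶ F₁'}
    {α₂ α₂' : F₂ ⟶ F₂'} {s₁ : α₁ ⟶ α₁'} {s₂ : α₂ ⟶ α₂'} (h : cell₃ s₁ = cell₃ s₂) :
    cell₃ (K.wl₃ G s₁) = cell₃ (K.wl₃ G s₂) := by
  cases h
  rfl

theorem cell₃_wr₃ {G₁ G₁' G₂ G₂' : K.Hom B C} {β₁ β₁' : G₁ ⟶ G₁'} {β₂ β₂' : G₂ ⟶ G₂'}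
    {t₁ : β₁ ⟶ β₁'} {t₂ : β₂ ⟶ β₂'} (h : cell₃ t₁ = cell₃ t₂) (F : K.Hom A B) :
    cell₃ (K.wr₃ t₁ F) = cell₃ (K.wr₃ t₂ F) := by
  cases h
  rfl

theorem cell₃_interchange {G₁ G₁' G₂ G₂' : K.Hom B C} {β₁ : G₁ ⟶ G₁'} {β₂ : G₂ ⟶ G₂'}
    {F₁ F₁' F₂ F₂' : K.Hom A B} {α₁ : F₁ ⟶ F₁'} {α₂ : F₂ ⟶ F₂'} (hβ : cell₂ β₁ = cell₂ β₂)
    (hα : cell₂ α₁ = cell₂ α₂) :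
    cell₃ (K.interchange β₁ α₁).hom = cell₃ (K.interchange β₂ α₂).hom := by
  cases hβ
  cases hα
  rfl

theorem cell₂_wl_wl (H : K.Hom C D) (G : K.Hom B C) {F F' : K.Hom A B} (α : F ⟶ F') :
    cell₂ (K.wl H (K.wl G α)) = cell₂ (K.wl (K.comp H G) α) :=
  cell₂_of_heq (K.assoc ..).symm (K.assoc ..).symm (K.wl_wl H G α)

theorem cell₂_wl_wr (H : K.Hom C D) {G G' : K.Hom B C} (β : G ⟶ G') (F : K.Hom A B) :
    cell₂ (K.wl H (K.wr β F)) = cell₂ (K.wr (K.wl H β) F) :=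
  cell₂_of_heq (K.assoc ..).symm (K.assoc ..).symm (K.wl_wr H β F)

theorem cell₂_wr_wr {H H' : K.Hom C D} (γ : H ⟶ H') (G : K.Hom B C) (F : K.Hom A B) :
    cell₂ (K.wr (K.wr γ G) F) = cell₂ (K.wr γ (K.comp G F)) :=
  cell₂_of_heq (K.assoc ..) (K.assoc ..) (K.wr_wr γ G F)

theorem cell₂_one_wl {F F' : K.Hom A B} (α : F ⟶ F') : cell₂ (K.wl (K.one B) α) = cell₂ α :=
  cell₂_of_heq (K.one_comp _) (K.one_comp _) (K.one_wl α)

theorem cell₂_wr_one {F F' : K.Hom A B} (α : F ⟶ F') : cell₂ (K.wr α (K.one A)) = cell₂ α :=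
  cell₂_of_heq (K.comp_one _) (K.comp_one _) (K.wr_one α)

theorem cell₃_wl₃_wl₃ (H : K.Hom C D) (G : K.Hom B C) {F F' : K.Hom A B} {α α' : F ⟶ F'}
    (s : α ⟶ α') : cell₃ (K.wl₃ H (K.wl₃ G s)) = cell₃ (K.wl₃ (K.comp H G) s) :=
  cell₃_of_heq (K.cell₂_wl_wl ..) (K.cell₂_wl_wl ..) (K.wl₃_wl₃ H G s)

theorem cell₃_wl₃_wr₃ (H : K.Hom C D) {G G' : K.Hom B C} {β β' : G ⟶ G'} (t : β ⟶ β')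
    (F : K.Hom A B) : cell₃ (K.wl₃ H (K.wr₃ t F)) = cell₃ (K.wr₃ (K.wl₃ H t) F) :=
  cell₃_of_heq (K.cell₂_wl_wr ..) (K.cell₂_wl_wr ..) (K.wl₃_wr₃ H t F)

theorem cell₃_wr₃_wr₃ {H H' : K.Hom C D} {γ γ' : H ⟶ H'} (r : γ ⟶ γ') (G : K.Hom B C)
    (F : K.Hom A B) : cell₃ (K.wr₃ (K.wr₃ r G) F) = cell₃ (K.wr₃ r (K.comp G F)) :=
  cell₃_of_heq (K.cell₂_wr_wr ..) (K.cell₂_wr_wr ..) (K.wr₃_wr₃ r G F)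

theorem cell₃_one_wl₃ {F F' : K.Hom A B} {α α' : F ⟶ F'} (s : α ⟶ α') :
    cell₃ (K.wl₃ (K.one B) s) = cell₃ s :=
  cell₃_of_heq (K.cell₂_one_wl _) (K.cell₂_one_wl _) (K.one_wl₃ s)

theorem cell₃_wr₃_one {F F' : K.Hom A B} {α α' : F ⟶ F'} (s : α ⟶ α') :
    cell₃ (K.wr₃ s (K.one A)) = cell₃ s :=
  cell₃_of_heq (K.cell₂_wr_one _) (K.cell₂_wr_one _) (K.wr₃_one s)

theorem cell₃_wl₃_whiskerLeft (G : K.Hom B C) {F F' F'' : K.Hom A B} (α : F ⟶ F')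
    {γ γ' : F' ⟶ F''} (s : γ ⟶ γ') :
    cell₃ (K.wl₃ G (α ◁ s)) = cell₃ (K.wl G α ◁ K.wl₃ G s) :=
  cell₃_of_heq (by rw [K.wl_comp]) (by rw [K.wl_comp]) (K.wl₃_whiskerLeft G α s)

theorem cell₃_wl₃_whiskerRight (G : K.Hom B C) {F F' F'' : K.Hom A B} {α α' : F ⟶ F'}
    (s : α ⟶ α') (γ : F' ⟶ F'') :
    cell₃ (K.wl₃ G (s ▷ γ)) = cell₃ (K.wl₃ G s ▷ K.wl G γ) :=
  cell₃_of_heq (by rw [K.wl_comp]) (by rw [K.wl_comp]) (K.wl₃_whiskerRight G s γ)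

theorem cell₃_wr₃_whiskerLeft {G G' G'' : K.Hom B C} (β : G ⟶ G') {δ δ' : G' ⟶ G''}
    (t : δ ⟶ δ') (F : K.Hom A B) :
    cell₃ (K.wr₃ (β ◁ t) F) = cell₃ (K.wr β F ◁ K.wr₃ t F) :=
  cell₃_of_heq (by rw [K.wr_comp]) (by rw [K.wr_comp]) (K.wr₃_whiskerLeft β t F)

theorem cell₃_wr₃_whiskerRight {G G' G'' : K.Hom B C} {β β' : G ⟶ G'} (t : β ⟶ β')
    (δ : G' ⟶ G'') (F : K.Hom A B) :
    cell₃ (K.wr₃ (t ▷ δ) F) = cell₃ (K.wr₃ t F ▷ K.wr δ F) :=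
  cell₃_of_heq (by rw [K.wr_comp]) (by rw [K.wr_comp]) (K.wr₃_whiskerRight t δ F)

theorem cell₃_interchange_comp_right {G G' : K.Hom B C} (β : G ⟶ G') {F F' F'' : K.Hom A B}
    (α : F ⟶ F') (γ : F' ⟶ F'') :
    cell₃ (K.interchange β (α ≫ γ)).hom =
      cell₃ ((K.interchange β α).hom ▷ K.wl G' γ ≫
        (α_ (K.wl G α) (K.wr β F') (K.wl G' γ)).hom ≫ K.wl G α ◁ (K.interchange β γ).hom) := by
  rw [cell₃_of_heq (by rw [K.wl_comp]) (by rw [K.wl_comp]) (K.interchange_comp_right β α γ),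
    cell₃_associator_inv_comp]
  exact cell₃_comp rfl (cell₃_comp rfl (cell₃_comp_associator_inv ..))

theorem cell₃_interchange_comp_left {G G' G'' : K.Hom B C} (β : G ⟶ G') (δ : G' ⟶ G'')
    {F F' : K.Hom A B} (α : F ⟶ F') :
    cell₃ (K.interchange (β ≫ δ) α).hom =
      cell₃ (K.wr β F ◁ (K.interchange δ α).hom ≫
        (α_ (K.wr β F) (K.wl G' α) (K.wr δ F')).inv ≫ (K.interchange β α).hom ▷ K.wr δ F') := by
  rw [cell₃_of_heq (by rw [K.wr_comp]) (by rw [K.wr_comp]) (K.interchange_comp_left β δ α),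
    cell₃_associator_comp]
  exact cell₃_comp rfl (cell₃_comp rfl (cell₃_comp_associator ..))

theorem cell₃_interchange_wr {H H' : K.Hom C D} (γ : H ⟶ H') {G G' : K.Hom B C} (β : G ⟶ G')
    (F : K.Hom A B) :
    cell₃ (K.interchange γ (K.wr β F)).hom = cell₃ (K.wr₃ (K.interchange γ β).hom F) :=
  cell₃_of_heq
    (by rw [K.wr_comp]; exact cell₂_comp (K.cell₂_wr_wr ..).symm (K.cell₂_wl_wr ..))
    (by rw [K.wr_comp]; exact cell₂_comp (K.cell₂_wl_wr ..) (K.cell₂_wr_wr ..).symm)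
    (K.interchange_wr γ β F)

theorem cell₃_interchange_mid {H H' : K.Hom C D} (γ : H ⟶ H') (G : K.Hom B C) {F F' : K.Hom A B}
    (α : F ⟶ F') :
    cell₃ (K.interchange γ (K.wl G α)).hom = cell₃ (K.interchange (K.wr γ G) α).hom :=
  cell₃_of_heq (cell₂_comp (K.cell₂_wr_wr ..).symm (K.cell₂_wl_wl ..))
    (cell₂_comp (K.cell₂_wl_wl ..) (K.cell₂_wr_wr ..).symm) (K.interchange_mid γ G α)

theorem cell₃_interchange_wl (H : K.Hom C D) {G G' : K.Hom B C} (β : G ⟶ G') {F F' : K.Hom A B}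
    (α : F ⟶ F') :
    cell₃ (K.wl₃ H (K.interchange β α).hom) = cell₃ (K.interchange (K.wl H β) α).hom :=
  cell₃_of_heq
    (by rw [K.wl_comp]; exact cell₂_comp (K.cell₂_wl_wr ..) (K.cell₂_wl_wl ..))
    (by rw [K.wl_comp]; exact cell₂_comp (K.cell₂_wl_wl ..) (K.cell₂_wl_wr ..))
    (K.interchange_wl H β α)

/-- The normalization `1_α = 1`: by the compatibility of interchange with composition, `1_α` is
idempotent. -/
theorem cell₃_interchange_id_left (G : K.Hom B C) {F F' : K.Hom A B} (α : F ⟶ F') :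
    cell₃ (K.interchange (𝟙 G) α).hom = cell₃ (𝟙 (K.wl G α)) := by
  refine cell₃_eq_id_of_idem _ (by rw [K.wr_id, Category.id_comp])
    (by rw [K.wr_id, Category.comp_id]) fun e he => ?_
  have h := K.cell₃_interchange_comp_left (𝟙 G) (𝟙 G) α
  rw [K.cell₃_interchange (by rw [Category.id_comp]) rfl] at h
  rw [h]
  refine cell₃_comp ?_ ?_
  · rw [cell₃_whiskerLeft (congrArg cell₂ (K.wr_id G F)) he.symm]
    exact cell₃_eqToHom_whiskerLeft rfl _
  · rw [cell₃_associator_inv_comp, cell₃_whiskerRight he.symm (congrArg cell₂ (K.wr_id G F'))]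
    exact cell₃_whiskerRight_eqToHom _ rfl

/-- The normalization `β_1 = 1`. -/
theorem cell₃_interchange_id_right {G G' : K.Hom B C} (β : G ⟶ G') (F : K.Hom A B) :
    cell₃ (K.interchange β (𝟙 F)).hom = cell₃ (𝟙 (K.wr β F)) := by
  refine cell₃_eq_id_of_idem _ (by rw [K.wl_id, Category.comp_id])
    (by rw [K.wl_id, Category.id_comp]) fun e he => ?_
  have h := K.cell₃_interchange_comp_right β (𝟙 F) (𝟙 F)
  rw [K.cell₃_interchange rfl (by rw [Category.id_comp])] at h
  rw [h]
  refine cell₃_comp ?_ ?_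
  · rw [cell₃_whiskerRight he.symm (congrArg cell₂ (K.wl_id G' F))]
    exact cell₃_whiskerRight_eqToHom _ rfl
  · rw [cell₃_associator_comp, cell₃_whiskerLeft (congrArg cell₂ (K.wl_id G F)) he.symm]
    exact cell₃_eqToHom_whiskerLeft rfl _

theorem wl₃_eqToHom (G : K.Hom B C) {F F' : K.Hom A B} {α α' : F ⟶ F'}
    (h : α = α') : K.wl₃ G (eqToHom h) = eqToHom (congrArg (K.wl G) h) := by
  subst h
  simp [K.wl₃_id]

theorem wr₃_eqToHom {G G' : K.Hom B C} {β β' : G ⟶ G'} (h : β = β')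
    (F : K.Hom A B) : K.wr₃ (eqToHom h) F = eqToHom (congrArg (fun β => K.wr β F) h) := by
  subst h
  simp [K.wr₃_id]

end GrayCells

/-! ### Left pseudoextensions as equivalences of categories -/

/-- A functor `Φ` is an equivalence if and only if every object `f` of its codomain has a lift up
to isomorphism which is terminal among the objects of the comma category of `Φ` over `f`, and for
which the comparison maps from isomorphisms are isomorphisms. -/
theorem isEquivalence_iff_exists_universal {D : Type*} [Category* D] {E : Type*} [Category* E]
    (Φ : D ⥤ E) :
    Φ.IsEquivalence ↔ ∀ f : E, ∃ (f' : D) (μ : Φ.obj f' ≅ f), ∀ (k : D) (ω : Φ.obj k ⟶ f),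
      ∃ ω' : k ⟶ f', Φ.map ω' ≫ μ.hom = ω ∧
        (∀ ω'' : k ⟶ f', Φ.map ω'' ≫ μ.hom = ω → ω'' = ω') ∧ (IsIso ω → IsIso ω') := by
  constructor
  · intro _ f
    refine ⟨Φ.objPreimage f, Φ.objObjPreimageIso f, fun k ω => ?_⟩
    have hmap := Φ.map_preimage (ω ≫ (Φ.objObjPreimageIso f).inv)
    refine ⟨_, (Iso.eq_comp_inv _).1 hmap, fun ω' hω' => Φ.map_injective ?_, fun hω => ?_⟩
    · rw [hmap]
      exact (Iso.eq_comp_inv _).2 hω'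
    · refine @isIso_of_reflects_iso _ _ _ _ _ _ _ Φ ?_ _
      rw [hmap]
      infer_instance
  · intro h
    -- The lift `e : k' ⟶ f'` of the identity of `Φ.obj k'` is invertible and `μ` is the inverse of
    -- its image, so that composition with `μ` can be undone by composition with `e⁻¹`.
    have key : ∀ k k' (ω : Φ.obj k ⟶ Φ.obj k'), ∃! ω' : k ⟶ k', Φ.map ω' = ω := by
      intro k k' ω
      obtain ⟨f', μ, hμ⟩ := h (Φ.obj k')
      obtain ⟨e, he, -, hiso⟩ := hμ k' (𝟙 _)
      have : IsIso e := hiso inferInstance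
      obtain ⟨ω', rfl, huniq, -⟩ := hμ k ω
      refine ⟨ω' ≫ inv e, ?_, fun y hy => ?_⟩
      · beta_reduce
        rw [Φ.map_comp, Φ.map_inv, IsIso.inv_eq_of_hom_inv_id he]
      · have : y ≫ e = ω' := huniq _ (by
          rw [Φ.map_comp, Category.assoc, he, Category.comp_id, hy])
        rw [← this, Category.assoc, IsIso.hom_inv_id, Category.comp_id]
    exact
      { faithful := ⟨fun hab => (key _ _ _).unique rfl hab.symm⟩
        full := ⟨fun ω => (key _ _ ω).exists⟩
        essSurj := ⟨fun f => by
          obtain ⟨f', μ, -⟩ := h f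
          exact ⟨f', ⟨μ⟩⟩⟩ }

section Extension

variable (K : GrayCategory.{w, v₂, v₁, u}) {X A B : K.Obj}

/-- The functor `k ↦ k J ∘ η` from 2-cells `L ⟶ Q` to 2-cells `H ⟶ Q J`. -/
def restrict (J : K.Hom X A) {H : K.Hom X B} {L : K.Hom A B} (η : H ⟶ K.comp L J)
    (Q : K.Hom A B) : (L ⟶ Q) ⥤ (H ⟶ K.comp Q J) where
  obj k := η ≫ K.wr k J
  map ω := η ◁ K.wr₃ ω J
  map_id k := by rw [K.wr₃_id, Bicategory.whiskerLeft_id]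
  map_comp ω ω' := by rw [K.wr₃_comp, Bicategory.whiskerLeft_comp]

theorem isLeftPseudoextension_iff_isEquivalence_restrict (J : K.Hom X A) (H : K.Hom X B)
    (L : K.Hom A B) (η : H ⟶ K.comp L J) :
    K.IsLeftPseudoextension J H L η ↔ ∀ Q, (K.restrict J η Q).IsEquivalence :=
  forall_congr' fun Q => (isEquivalence_iff_exists_universal (K.restrict J η Q)).symm

theorem isLeftPseudoextension_congr {J : K.Hom X A} {H H' : K.Hom X B} {L L' : K.Hom A B}
    {η : H ⟶ K.comp L J} {η' : H' ⟶ K.comp L' J} (hL : L = L') (h : cell₂ η = cell₂ η') :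
    K.IsLeftPseudoextension J H L η ↔ K.IsLeftPseudoextension J H' L' η' := by
  subst hL
  obtain rfl : H = H' := congrArg (fun x => x.1) h
  rw [cell₂_injective h]

end Extension

/-! ### The pseudonatural transformations induced by a unit and a counit -/

section Transformations

variable {K : GrayCategory.{w, v₂, v₁, u}} {X A B : K.Obj} {F : K.Hom X A} {U : K.Hom A X}
  (η : K.one X ⟶ K.comp U F) (ϵ : K.comp F U ⟶ K.one A)

/-- The 2-cell `G η : G ⟶ (G U) F`. -/
def unitAt (G : K.Hom X B) : G ⟶ K.comp (K.comp G U) F :=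
  eqToHom (K.comp_one G).symm ≫ K.wl G η ≫ eqToHom (K.assoc G U F).symm

/-- The 2-cell `Q ϵ : (Q F) U ⟶ Q`. -/
def counitAt (Q : K.Hom A B) : K.comp (K.comp Q F) U ⟶ Q :=
  eqToHom (K.assoc Q F U) ≫ K.wl Q ϵ ≫ eqToHom (K.comp_one Q)

theorem cell₂_unitAt (G : K.Hom X B) : cell₂ (unitAt η G) = cell₂ (K.wl G η) := by
  simp [unitAt]

theorem cell₂_counitAt (Q : K.Hom A B) : cell₂ (counitAt ϵ Q) = cell₂ (K.wl Q ϵ) := by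
  simp [counitAt]

/-- The interchange cell `β_η : G' η ∘ β ⇛ (β U) F ∘ G η`. -/
def unitNat {G G' : K.Hom X B} (β : G ⟶ G') :
    β ≫ unitAt η G' ≅ unitAt η G ≫ K.wr (K.wr β U) F :=
  castIso (K.interchange β η)
    (cell₂_comp (K.cell₂_wr_one β).symm (cell₂_unitAt η G'))
    (cell₂_comp (cell₂_unitAt η G) (K.cell₂_wr_wr β U F))

/-- The interchange cell `k_ϵ : Q' ϵ ∘ (k F) U ⇛ k ∘ Q ϵ`. -/
def counitNat {Q Q' : K.Hom A B} (k : Q ⟶ Q') :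
    K.wr (K.wr k F) U ≫ counitAt ϵ Q' ≅ counitAt ϵ Q ≫ k :=
  castIso (K.interchange k ϵ)
    (cell₂_comp (K.cell₂_wr_wr k F U) (cell₂_counitAt ϵ Q'))
    (cell₂_comp (cell₂_counitAt ϵ Q) (K.cell₂_wr_one k).symm)

theorem cell₃_unitNat {G G' : K.Hom X B} (β : G ⟶ G') :
    cell₃ (unitNat η β).hom = cell₃ (K.interchange β η).hom :=
  cell₃_castIso_hom ..

theorem cell₃_counitNat {Q Q' : K.Hom A B} (k : Q ⟶ Q') :
    cell₃ (counitNat ϵ k).hom = cell₃ (K.interchange k ϵ).hom :=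
  cell₃_castIso_hom ..

theorem unitNat_naturality {G G' : K.Hom X B} {β β' : G ⟶ G'} (t : β ⟶ β') :
    t ▷ unitAt η G' ≫ (unitNat η β').hom =
      (unitNat η β).hom ≫ unitAt η G ◁ K.wr₃ (K.wr₃ t U) F := by
  apply cell₃_injective
  trans cell₃ (K.wr₃ t (K.one X) ▷ K.wl G' η ≫ (K.interchange β' η).hom)
  · exact cell₃_comp (cell₃_whiskerRight (K.cell₃_wr₃_one t).symm (cell₂_unitAt ..))
      (cell₃_unitNat ..)
  · rw [K.interchange_natural_left]
    exact cell₃_comp (cell₃_unitNat ..).symm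
      (cell₃_whiskerLeft (cell₂_unitAt ..).symm (K.cell₃_wr₃_wr₃ ..).symm)

theorem counitNat_naturality {Q Q' : K.Hom A B} {k k' : Q ⟶ Q'} (t : k ⟶ k') :
    K.wr₃ (K.wr₃ t F) U ▷ counitAt ϵ Q' ≫ (counitNat ϵ k').hom =
      (counitNat ϵ k).hom ≫ counitAt ϵ Q ◁ t := by
  apply cell₃_injective
  trans cell₃ (K.wr₃ t (K.comp F U) ▷ K.wl Q' ϵ ≫ (K.interchange k' ϵ).hom)
  · exact cell₃_comp (cell₃_whiskerRight (K.cell₃_wr₃_wr₃ ..) (cell₂_counitAt ..))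
      (cell₃_counitNat ..)
  · rw [K.interchange_natural_left]
    exact cell₃_comp (cell₃_counitNat ..).symm
      (cell₃_whiskerLeft (cell₂_counitAt ..).symm (K.cell₃_wr₃_one t))

theorem cell₃_unitNat_comp {G G' G'' : K.Hom X B} (β : G ⟶ G') (δ : G' ⟶ G'') :
    cell₃ (unitNat η (β ≫ δ)).hom =
      cell₃ (β ◁ (unitNat η δ).hom ≫ (α_ _ _ _).inv ≫ (unitNat η β).hom ▷ K.wr (K.wr δ U) F) := by
  rw [cell₃_unitNat, K.cell₃_interchange_comp_left]
  refine cell₃_comp (cell₃_whiskerLeft (K.cell₂_wr_one β) (cell₃_unitNat ..).symm) ?_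
  rw [cell₃_associator_inv_comp, cell₃_associator_inv_comp]
  exact cell₃_whiskerRight (cell₃_unitNat ..).symm (K.cell₂_wr_wr ..).symm

/-- The 2-cell `ϵ F : (F U) F ⟶ F`. -/
def counitWhisker : K.comp (K.comp F U) F ⟶ F := K.wr ϵ F ≫ eqToHom (K.one_comp F)

theorem cell₂_counitWhisker : cell₂ (counitWhisker ϵ) = cell₂ (K.wr ϵ F) := by
  simp [counitWhisker]

theorem triangleLeft_eq : triangleLeft η ϵ = unitAt η F ≫ counitWhisker ϵ := by
  simp [triangleLeft, unitAt, counitWhisker]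

theorem triangleRight_eq : triangleRight η ϵ =
    (eqToHom (K.one_comp U).symm ≫ K.wr η U) ≫ counitAt ϵ U := by
  simp [triangleRight, counitAt]

theorem unitAt_comp_wr_counitAt (Q : K.Hom A B) :
    unitAt η (K.comp Q F) ≫ K.wr (counitAt ϵ Q) F = K.wl Q (triangleLeft η ϵ) := by
  apply cell₂_injective
  rw [triangleLeft_eq, K.wl_comp]
  refine cell₂_comp ?_ ?_
  · rw [cell₂_unitAt, ← K.cell₂_wl_wl]
    exact K.cell₂_wl Q (cell₂_unitAt ..).symm
  · rw [K.cell₂_wr (cell₂_counitAt ϵ Q) F, ← K.cell₂_wl_wr]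
    exact K.cell₂_wl Q (cell₂_counitWhisker ..).symm

theorem wr_unitAt_comp_counitAt (G : K.Hom X B) :
    K.wr (unitAt η G) U ≫ counitAt ϵ (K.comp G U) = K.wl G (triangleRight η ϵ) := by
  apply cell₂_injective
  rw [triangleRight_eq, K.wl_comp]
  refine cell₂_comp ?_ ?_
  · rw [K.cell₂_wr (cell₂_unitAt η G) U, ← K.cell₂_wl_wr]
    exact K.cell₂_wl G (by simp)
  · rw [cell₂_counitAt, ← K.cell₂_wl_wl]
    exact K.cell₂_wl G (cell₂_counitAt ..).symm

end Transformations

/-! ### Pseudoadjunctions give absolute left pseudoextensions -/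

section Absolute

variable {K : GrayCategory.{w, v₂, v₁, u}} {X A B : K.Obj} {F : K.Hom X A} {U : K.Hom A X}
  (η : K.one X ⟶ K.comp U F) (ϵ : K.comp F U ⟶ K.one A)

/-- The functor `f ↦ Q ϵ ∘ f U` from 2-cells `G ⟶ Q F` to 2-cells `G U ⟶ Q`. -/
def mate (G : K.Hom X B) (Q : K.Hom A B) : (G ⟶ K.comp Q F) ⥤ (K.comp G U ⟶ Q) where
  obj f := K.wr f U ≫ counitAt ϵ Q
  map ω := K.wr₃ ω U ▷ counitAt ϵ Q
  map_id f := by rw [K.wr₃_id, Bicategory.id_whiskerRight]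
  map_comp ω ω' := by rw [K.wr₃_comp, Bicategory.comp_whiskerRight]

variable {η ϵ}

/-- `G t`, as a 3-cell from the triangle of `unitAt` and `counitAt` to the identity. -/
def wlTriangleRightIso (t : triangleRight η ϵ ≅ 𝟙 U) (G : K.Hom X B) :
    K.wr (unitAt η G) U ≫ counitAt ϵ (K.comp G U) ≅ 𝟙 (K.comp G U) :=
  eqToIso (wr_unitAt_comp_counitAt η ϵ G) ≪≫ K.wlIso G t ≪≫ eqToIso (K.wl_id G U)

/-- `Q s`, as a 3-cell from the identity to the triangle of `unitAt` and `counitAt`. -/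
def wlTriangleLeftIso (s : 𝟙 F ≅ triangleLeft η ϵ) (Q : K.Hom A B) :
    𝟙 (K.comp Q F) ≅ unitAt η (K.comp Q F) ≫ K.wr (counitAt ϵ Q) F :=
  eqToIso (K.wl_id Q F).symm ≪≫ K.wlIso Q s ≪≫ eqToIso (unitAt_comp_wr_counitAt η ϵ Q).symm

/-- The invertible 3-cell `Q ϵ ∘ (k F ∘ G η) U ⇛ k` given by interchange and `G t`. -/
def mateRestrictIso (t : triangleRight η ϵ ≅ 𝟙 U) (G : K.Hom X B) (Q : K.Hom A B)
    (k : K.comp G U ⟶ Q) :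
    K.wr (unitAt η G ≫ K.wr k F) U ≫ counitAt ϵ Q ≅ k :=
  eqToIso (by rw [K.wr_comp, Category.assoc]) ≪≫
    whiskerLeftIso (K.wr (unitAt η G) U) (counitNat ϵ k) ≪≫ (α_ _ _ _).symm ≪≫
      whiskerRightIso (wlTriangleRightIso t G) k ≪≫ λ_ k

/-- The invertible 3-cell `(Q ϵ ∘ f U) F ∘ G η ⇛ f` given by interchange and `Q s`. -/
def restrictMateIso (s : 𝟙 F ≅ triangleLeft η ϵ) (G : K.Hom X B) (Q : K.Hom A B)
    (f : G ⟶ K.comp Q F) :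
    unitAt η G ≫ K.wr (K.wr f U ≫ counitAt ϵ Q) F ≅ f :=
  eqToIso (by rw [K.wr_comp, Category.assoc]) ≪≫
    whiskerRightIso (unitNat η f).symm (K.wr (counitAt ϵ Q) F) ≪≫ α_ _ _ _ ≪≫
      whiskerLeftIso f (wlTriangleLeftIso s Q).symm ≪≫ ρ_ f

theorem mateRestrictIso_naturality (t : triangleRight η ϵ ≅ 𝟙 U) (G : K.Hom X B) (Q : K.Hom A B)
    {k k' : K.comp G U ⟶ Q} (ω : k ⟶ k') :
    K.wr₃ (unitAt η G ◁ K.wr₃ ω F) U ▷ counitAt ϵ Q ≫ (mateRestrictIso t G Q k').hom =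
      (mateRestrictIso t G Q k).hom ≫ ω := by
  apply cell₃_injective
  trans cell₃ (K.wr (unitAt η G) U ◁ (K.wr₃ (K.wr₃ ω F) U ▷ counitAt ϵ Q) ≫
    K.wr (unitAt η G) U ◁ (counitNat ϵ k').hom ≫ (α_ _ _ _).inv ≫
      (wlTriangleRightIso t G).hom ▷ k' ≫ (λ_ k').hom)
  · refine cell₃_comp ?_ (by simp [mateRestrictIso])
    rw [← cell₃_whisker_assoc]
    exact cell₃_whiskerRight (K.cell₃_wr₃_whiskerLeft ..) rfl
  · rw [← Bicategory.whiskerLeft_comp_assoc, counitNat_naturality]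
    trans cell₃ ((K.wr (unitAt η G) U ◁ (counitNat ϵ k).hom ≫ (α_ _ _ _).inv ≫
      (wlTriangleRightIso t G).hom ▷ k ≫ (λ_ k).hom) ≫ ω)
    · congr 1
      simp only [Category.assoc, Bicategory.whiskerLeft_comp]
      rw [← leftUnitor_naturality, ← whisker_exchange_assoc, associator_inv_naturality_right_assoc]
    · exact cell₃_comp (by simp [mateRestrictIso]) rfl

theorem restrictMateIso_naturality (s : 𝟙 F ≅ triangleLeft η ϵ) (G : K.Hom X B) (Q : K.Hom A B)
    {f f' : G ⟶ K.comp Q F} (ω : f ⟶ f') :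
    unitAt η G ◁ K.wr₃ (K.wr₃ ω U ▷ counitAt ϵ Q) F ≫ (restrictMateIso s G Q f').hom =
      (restrictMateIso s G Q f).hom ≫ ω := by
  have hnat : unitAt η G ◁ K.wr₃ (K.wr₃ ω U) F ≫ (unitNat η f').inv =
      (unitNat η f).inv ≫ ω ▷ unitAt η (K.comp Q F) := by
    rw [Iso.comp_inv_eq, Category.assoc, unitNat_naturality, Iso.inv_hom_id_assoc]
  apply cell₃_injective
  trans cell₃ ((unitAt η G ◁ K.wr₃ (K.wr₃ ω U) F) ▷ K.wr (counitAt ϵ Q) F ≫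
    (unitNat η f').inv ▷ K.wr (counitAt ϵ Q) F ≫ (α_ _ _ _).hom ≫
      f' ◁ (wlTriangleLeftIso s Q).inv ≫ (ρ_ f').hom)
  · refine cell₃_comp ?_ (by simp [restrictMateIso])
    rw [cell₃_whisker_assoc]
    exact cell₃_whiskerLeft rfl (K.cell₃_wr₃_whiskerRight ..)
  · rw [← Bicategory.comp_whiskerRight_assoc, hnat]
    trans cell₃ (((unitNat η f).inv ▷ K.wr (counitAt ϵ Q) F ≫ (α_ _ _ _).hom ≫
      f ◁ (wlTriangleLeftIso s Q).inv ≫ (ρ_ f).hom) ≫ ω)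
    · congr 1
      simp only [Category.assoc, Bicategory.comp_whiskerRight]
      rw [← rightUnitor_naturality, whisker_exchange_assoc, associator_naturality_left_assoc]
    · exact cell₃_comp (by simp [restrictMateIso]) rfl

/-- For a pseudoadjunction, `f ↦ Q ϵ ∘ f U` is inverse to restriction along `G η`. -/
theorem isLeftPseudoextension_unitAt (s : 𝟙 F ≅ triangleLeft η ϵ) (t : triangleRight η ϵ ≅ 𝟙 U)
    (G : K.Hom X B) : K.IsLeftPseudoextension F G (K.comp G U) (unitAt η G) := by
  rw [isLeftPseudoextension_iff_isEquivalence_restrict]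
  intro Q
  exact (CategoryTheory.Equivalence.mk (K.restrict F (unitAt η G) Q) (mate ϵ G Q)
    (NatIso.ofComponents (fun k => mateRestrictIso t G Q k)
      (fun ω => mateRestrictIso_naturality t G Q ω)).symm
    (NatIso.ofComponents (fun f => restrictMateIso s G Q f)
      (fun ω => restrictMateIso_naturality s G Q ω))).isEquivalence_functor

theorem preservesLeftPseudoextension_iff_unitAt (η : K.one X ⟶ K.comp U F) (G : K.Hom X B) :
    K.PreservesLeftPseudoextension G F (K.one X) U η ↔
      K.IsLeftPseudoextension F G (K.comp G U) (unitAt η G) :=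
  K.isLeftPseudoextension_congr rfl (by simp [unitAt])

theorem isLeftPseudoextension_iff_unitAt (η : K.one X ⟶ K.comp U F) :
    K.IsLeftPseudoextension F (K.one X) U η ↔
      K.IsLeftPseudoextension F (K.one X) (K.comp (K.one X) U) (unitAt η (K.one X)) :=
  K.isLeftPseudoextension_congr (K.one_comp U).symm
    ((cell₂_unitAt ..).trans (K.cell₂_one_wl η)).symm

theorem Pseudoadjunction.isAbsoluteLeftPseudoextension (P : Pseudoadjunction F U) :
    K.IsAbsoluteLeftPseudoextension F (K.one X) U P.unit :=
  ⟨(isLeftPseudoextension_iff_unitAt _).2 (isLeftPseudoextension_unitAt P.s P.t _),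
    fun _ G => (preservesLeftPseudoextension_iff_unitAt _ G).2
      (isLeftPseudoextension_unitAt P.s P.t G)⟩

end Absolute

/-! ### The second coherence identity -/

section Swallowtail

variable {C : Type v₁} [Bicategory.{w, v₂} C]

/-- The computation by which one swallowtail identity implies the other, in terms of the cells
`n = F η`, `n₁ = F U F η`, `n₂ = F η U F`, `e = ϵ F`, `e₁ = F U ϵ F`, `e₂ = ϵ F U F`, `s₁ = F U s`,
`s₂ = s U F`, `ν = F η_η`, `φ = ϵ_{F η}`, `ψ = ϵ_ϵ F` and `t = F t F`. The hypotheses `h₁` and `h₂` are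
the naturality of interchange with respect to `s` in the two variables, and `h₃` is the image under
`F (-)` of the first swallowtail identity. -/
theorem whiskerLeft_eq_of_triangle {a b c : C} {n : a ⟶ b} {e : b ⟶ a} {n₁ n₂ : b ⟶ c}
    {e₁ e₂ : c ⟶ b} (s : 𝟙 a ≅ n ≫ e) (s₁ : 𝟙 b ⟶ n₁ ≫ e₁) (s₂ : 𝟙 b ⟶ n₂ ≫ e₂)
    (ν : n ≫ n₁ ⟶ n ≫ n₂) (φ : e ≫ n ⟶ n₁ ≫ e₂) (ψ : e₂ ≫ e ⟶ e₁ ≫ e) (t : n₂ ≫ e₁ ⟶ 𝟙 b)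
    (h₁ : n ◁ s₂ = (ρ_ n).hom ≫ (λ_ n).inv ≫ s.hom ▷ n ≫ (α_ n e n).hom ≫ n ◁ φ ≫
      (α_ n n₁ e₂).inv ≫ ν ▷ e₂ ≫ (α_ n n₂ e₂).hom)
    (h₂ : (ρ_ e).inv ≫ e ◁ s.hom ≫ (α_ e n e).inv ≫ φ ▷ e ≫ (α_ n₁ e₂ e).hom ≫ n₁ ◁ ψ =
      (λ_ e).inv ≫ s₁ ▷ e ≫ (α_ n₁ e₁ e).hom)
    (h₃ : (ρ_ n).inv ≫ n ◁ s₁ ≫ (α_ n n₁ e₁).inv ≫ ν ▷ e₁ ≫ (α_ n n₂ e₁).hom ≫ n ◁ t ≫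
      (ρ_ n).hom = 𝟙 n) :
    n ◁ ((λ_ e).inv ≫ s₂ ▷ e ≫ (α_ n₂ e₂ e).hom ≫ n₂ ◁ ψ ≫ (α_ n₂ e₁ e).inv ≫ t ▷ e ≫
      (λ_ e).hom) = 𝟙 (n ≫ e) := by
  -- `s` is invertible, so whiskering it by `n ≫ e` on the left or on the right is the same.
  have hs : (λ_ (n ≫ e)).inv ≫ s.hom ▷ (n ≫ e) = (ρ_ (n ≫ e)).inv ≫ (n ≫ e) ◁ s.hom := by
    rw [← cancel_epi s.hom, leftUnitor_inv_naturality_assoc, whisker_exchange,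
      rightUnitor_inv_naturality_assoc, ← unitors_inv_equal]
  calc
    _ = 𝟙 (n ≫ e) ⊗≫ (n ◁ s₂) ▷ e ⊗≫ n ◁ n₂ ◁ ψ ⊗≫ n ◁ t ▷ e ⊗≫ 𝟙 (n ≫ e) := by
      bicategory
    _ = 𝟙 (n ≫ e) ⊗≫ s.hom ▷ (n ≫ e) ⊗≫ n ◁ φ ▷ e ⊗≫ (ν ▷ (e₂ ≫ e) ≫ (n ≫ n₂) ◁ ψ) ⊗≫
        n ◁ t ▷ e ⊗≫ 𝟙 (n ≫ e) := by
      rw [h₁]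
      bicategory
    _ = ((λ_ (n ≫ e)).inv ≫ s.hom ▷ (n ≫ e)) ⊗≫ n ◁ φ ▷ e ⊗≫ n ◁ n₁ ◁ ψ ⊗≫
        ν ▷ e₁ ▷ e ⊗≫ n ◁ t ▷ e ⊗≫ 𝟙 (n ≫ e) := by
      rw [← whisker_exchange]
      bicategory
    _ = n ◁ ((ρ_ e).inv ≫ e ◁ s.hom ≫ (α_ e n e).inv ≫ φ ▷ e ≫ (α_ n₁ e₂ e).hom ≫ n₁ ◁ ψ) ⊗≫
        ν ▷ e₁ ▷ e ⊗≫ n ◁ t ▷ e ⊗≫ 𝟙 (n ≫ e) := by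
      rw [hs]
      bicategory
    _ = ((ρ_ n).inv ≫ n ◁ s₁ ≫ (α_ n n₁ e₁).inv ≫ ν ▷ e₁ ≫ (α_ n n₂ e₁).hom ≫ n ◁ t ≫
        (ρ_ n).hom) ▷ e := by
      rw [h₂]
      bicategory
    _ = 𝟙 (n ≫ e) := by
      rw [h₃, Bicategory.id_whiskerRight]

end Swallowtail

/-! ### Deriving the counit coherence from the unit coherence -/

section Coherence

variable {K : GrayCategory.{w, v₂, v₁, u}} {X A : K.Obj} {F : K.Hom X A} {U : K.Hom A X}
  {η : K.one X ⟶ K.comp U F} {ϵ : K.comp F U ⟶ K.one A}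

theorem cell₂_wl_counitMid :
    cell₂ (K.wl F (counitMid ϵ U F)) = cell₂ (K.wr (counitAt ϵ (K.comp F U)) F) := by
  rw [K.cell₂_wr (cell₂_counitAt ϵ _) F, ← K.cell₂_wl_wr, ← K.cell₂_wl_wl]
  exact K.cell₂_wl F (by simp [counitMid])

theorem cell₂_wr_unitMid :
    cell₂ (K.wr (unitMid η F U) F) = cell₂ (K.wr (K.wr (unitAt η F) U) F) := by
  refine K.cell₂_wr ?_ F
  rw [K.cell₂_wr (cell₂_unitAt η F) U, ← K.cell₂_wl_wr]
  simp [unitMid]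

/-- The 3-cell `(ϵ_ϵ) F`. -/
def counitInterchangeWhisker (ϵ : K.comp F U ⟶ K.one A) :
    K.wr (K.wr (counitWhisker ϵ) U) F ≫ counitWhisker ϵ ≅
      K.wr (counitAt ϵ (K.comp F U)) F ≫ counitWhisker ϵ :=
  castIso (K.wrIso (K.interchange ϵ ϵ) F)
    (by
      rw [K.wr_comp]
      refine cell₂_comp (K.cell₂_wr ?_ F) ?_
      · rw [K.cell₂_wr (cell₂_counitWhisker ϵ) U, K.cell₂_wr_wr]
      · rw [cell₂_counitWhisker, K.cell₂_wr (K.cell₂_one_wl ϵ) F])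
    (by
      rw [K.wr_comp]
      refine cell₂_comp (K.cell₂_wr (cell₂_counitAt ..) F) ?_
      rw [cell₂_counitWhisker, K.cell₂_wr (K.cell₂_wr_one ϵ) F])

/-- Naturality of interchange with `η` along `s : 1 ⟶ ϵ F ∘ F η`. -/
theorem unitNat_triangleLeft (s : 𝟙 F ⟶ unitAt η F ≫ counitWhisker ϵ) :
    unitAt η F ◁ (eqToHom (by rw [K.wr_id, K.wr_id]) ≫ K.wr₃ (K.wr₃ s U) F ≫
        eqToHom (by rw [K.wr_comp, K.wr_comp])) =
      (ρ_ _).hom ≫ (λ_ _).inv ≫ s ▷ unitAt η F ≫ (α_ _ _ _).hom ≫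
        unitAt η F ◁ (unitNat η (counitWhisker ϵ)).hom ≫ (α_ _ _ _).inv ≫
          (unitNat η (unitAt η F)).hom ▷ K.wr (K.wr (counitWhisker ϵ) U) F ≫ (α_ _ _ _).hom := by
  apply cell₃_injective
  trans cell₃ ((unitNat η (𝟙 F)).hom ≫ unitAt η F ◁ K.wr₃ (K.wr₃ s U) F)
  · rw [cell₃_comp_of_left_id
      ((cell₃_unitNat ..).trans (K.cell₃_interchange_id_left ..))]
    exact cell₃_whiskerLeft rfl (by simp)
  · rw [← unitNat_naturality]
    simp only [Strict.leftUnitor_eqToIso, Strict.rightUnitor_eqToIso, eqToIso.hom, eqToIso.inv,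
      cell₃_eqToHom_comp]
    refine cell₃_comp rfl ?_
    rw [cell₃_unitNat_comp, cell₃_associator_comp]
    exact cell₃_comp rfl (cell₃_comp rfl (cell₃_comp_associator ..).symm)

/-- Naturality of interchange with `ϵ` along `s : 1 ⟶ ϵ F ∘ F η`. -/
theorem interchange_counit_triangleLeft (s : 𝟙 F ≅ triangleLeft η ϵ) :
    (ρ_ (counitWhisker ϵ)).inv ≫
      counitWhisker ϵ ◁ (s ≪≫ eqToIso (triangleLeft_eq η ϵ)).hom ≫ (α_ _ _ _).inv ≫
        (unitNat η (counitWhisker ϵ)).hom ▷ counitWhisker ϵ ≫ (α_ _ _ _).hom ≫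
          unitAt η (K.comp (K.comp F U) F) ◁ (counitInterchangeWhisker ϵ).hom =
      (λ_ _).inv ≫ (wlTriangleLeftIso s (K.comp F U)).hom ▷ counitWhisker ϵ ≫ (α_ _ _ _).hom := by
  set s' := s ≪≫ eqToIso (triangleLeft_eq η ϵ)
  have hs' : cell₃ s'.hom = cell₃ s.hom := by simp [s']
  apply cell₃_injective
  trans cell₃ (K.wr ϵ F ◁ K.wl₃ (K.one A) s'.hom ≫
    (K.interchange ϵ (unitAt η F ≫ counitWhisker ϵ)).hom)
  · simp only [Strict.rightUnitor_eqToIso, eqToIso.inv, cell₃_eqToHom_comp]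
    refine cell₃_comp (cell₃_whiskerLeft (cell₂_counitWhisker ϵ) (K.cell₃_one_wl₃ _).symm) ?_
    rw [cell₃_associator_inv_comp, K.cell₃_interchange_comp_right]
    refine cell₃_comp (cell₃_whiskerRight ?_ (K.cell₂_one_wl _).symm) ?_
    · rw [cell₃_unitNat, K.cell₃_interchange (cell₂_counitWhisker ϵ) rfl,
        ← K.cell₃_interchange_mid]
      exact K.cell₃_interchange rfl (cell₂_unitAt ..).symm
    · rw [cell₃_associator_comp, cell₃_associator_comp]
      refine cell₃_whiskerLeft ?_ ?_
      · rw [cell₂_unitAt, ← K.cell₂_wl_wl]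
        exact K.cell₂_wl _ (cell₂_unitAt ..).symm
      · rw [K.cell₃_interchange rfl (cell₂_counitWhisker ϵ), K.cell₃_interchange_wr]
        exact cell₃_castIso_hom ..
  · rw [K.interchange_natural_right, cell₃_comp_of_left_id (K.cell₃_interchange_id_right ..)]
    simp only [Strict.leftUnitor_eqToIso, eqToIso.inv, cell₃_eqToHom_comp, cell₃_comp_associator]
    refine cell₃_whiskerRight ?_ (cell₂_counitWhisker ϵ).symm
    rw [K.cell₃_wl₃ _ hs']
    simp [wlTriangleLeftIso, wlIso]

/-- The image of the first coherence identity under `F (-)`. -/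
theorem wl₃_unitPasting (s : 𝟙 F ≅ triangleLeft η ϵ) (t : triangleRight η ϵ ≅ 𝟙 U)
    (h : unitPasting η ϵ s.hom t.hom = 𝟙 η) :
    (ρ_ (unitAt η F)).inv ≫ unitAt η F ◁ (wlTriangleLeftIso s (K.comp F U)).hom ≫
      (α_ _ _ _).inv ≫ (unitNat η (unitAt η F)).hom ▷ K.wr (counitAt ϵ (K.comp F U)) F ≫
        (α_ _ _ _).hom ≫ unitAt η F ◁ (eqToHom (K.wr_comp _ _ F).symm ≫
          K.wr₃ (wlTriangleRightIso t F).hom F ≫ eqToHom (K.wr_id _ F)) ≫ (ρ_ _).hom = 𝟙 _ := by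
  apply cell₃_injective
  trans cell₃ (K.wl₃ F (unitPasting η ϵ s.hom t.hom))
  · simp only [unitPasting, K.wl₃_comp, K.wl₃_eqToHom, Strict.rightUnitor_eqToIso, eqToIso.inv,
      eqToIso.hom, cell₃_eqToHom_comp]
    refine cell₃_comp ?_ ?_
    · rw [K.cell₃_wl₃_whiskerLeft]
      refine cell₃_whiskerLeft (cell₂_unitAt ..) ?_
      rw [K.cell₃_wl₃_wl₃]
      simp [wlTriangleLeftIso, wlIso]
    rw [cell₃_associator_inv_comp, cell₃_eqToHom_comp]
    refine cell₃_comp ?_ ?_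
    · rw [K.cell₃_wl₃_whiskerRight]
      refine cell₃_whiskerRight ?_ cell₂_wl_counitMid.symm
      rw [K.cell₃_wl₃ F (cell₃_eqToHom_whiskerLeft ..), K.cell₃_interchange_wl, cell₃_unitNat]
      exact K.cell₃_interchange (cell₂_unitAt ..) rfl
    rw [cell₃_associator_comp, cell₃_eqToHom_comp, cell₃_comp_eqToHom, cell₃_comp_eqToHom,
      K.cell₃_wl₃_whiskerLeft]
    refine cell₃_whiskerLeft (cell₂_unitAt ..) ?_
    rw [K.cell₃_wl₃_wr₃, cell₃_eqToHom_comp, cell₃_comp_eqToHom]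
    exact K.cell₃_wr₃ (by simp [wlTriangleRightIso, wlIso]) F
  · rw [h, K.wl₃_id]
    exact cell₃_id (cell₂_unitAt ..).symm

/-- The first coherence identity implies the second one after restriction along `F η`. -/
theorem unitAt_whiskerLeft_wr₃_counitPasting (s : 𝟙 F ≅ triangleLeft η ϵ)
    (t : triangleRight η ϵ ≅ 𝟙 U) (h : unitPasting η ϵ s.hom t.hom = 𝟙 η) :
    unitAt η F ◁ K.wr₃ (counitPasting η ϵ s.hom t.hom) F = 𝟙 _ := by
  apply cell₃_injective
  refine Eq.trans ?_ ((congrArg cell₃ (whiskerLeft_eq_of_triangle _ _ _ _ _ _ _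
    (unitNat_triangleLeft (s ≪≫ eqToIso (triangleLeft_eq η ϵ)).hom)
    (interchange_counit_triangleLeft s) (wl₃_unitPasting s t h))).trans
      (cell₃_id (cell₂_comp rfl (cell₂_counitWhisker ϵ))))
  refine cell₃_whiskerLeft rfl ?_
  simp only [counitPasting, K.wr₃_comp, K.wr₃_eqToHom, Strict.leftUnitor_eqToIso, eqToIso.inv,
    eqToIso.hom, cell₃_eqToHom_comp]
  refine cell₃_comp ?_ ?_
  · rw [K.cell₃_wr₃_whiskerRight]
    refine cell₃_whiskerRight ?_ (cell₂_counitWhisker ϵ).symm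
    rw [cell₃_eqToHom_comp, cell₃_comp_eqToHom]
    exact K.cell₃_wr₃ (K.cell₃_wr₃ (by simp) U) F
  rw [cell₃_associator_comp, cell₃_eqToHom_comp]
  refine cell₃_comp ?_ ?_
  · rw [K.cell₃_wr₃_whiskerLeft]
    refine cell₃_whiskerLeft cell₂_wr_unitMid ?_
    rw [K.cell₃_wr₃ (cell₃_whiskerRight_eqToHom ..)]
    exact (cell₃_castIso_hom (K.wrIso (K.interchange ϵ ϵ) F) _ _).symm
  rw [cell₃_associator_inv_comp, cell₃_eqToHom_comp, cell₃_comp_eqToHom, cell₃_comp_eqToHom,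
    K.cell₃_wr₃_whiskerRight]
  refine cell₃_whiskerRight ?_ (cell₂_counitWhisker ϵ).symm
  rw [cell₃_eqToHom_comp, cell₃_comp_eqToHom]
  exact K.cell₃_wr₃ (by simp [wlTriangleRightIso, wlIso]) F

end Coherence

/-! ### Pseudoadjunctions from preserved pseudoextensions -/

section Construction

variable {K : GrayCategory.{w, v₂, v₁, u}} {X A : K.Obj} {F : K.Hom X A} {U : K.Hom A X}
  {η : K.one X ⟶ K.comp U F} {ϵ : K.comp F U ⟶ K.one A}

/-- The part of `unitPasting` that does not involve `t`: the pasting of `U s` and `η_η`. -/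
def unitPastingLeft (s : 𝟙 F ≅ triangleLeft η ϵ) : η ≅ η ≫ K.wr (triangleRight η ϵ) F :=
  eqToIso (by simp [K.wl_id]) ≪≫ whiskerLeftIso η (K.wlIso U s) ≪≫
    eqToIso (unit_comp_wl_triangleLeft η ϵ) ≪≫
      whiskerRightIso (whiskerLeftIso (eqToHom (K.comp_one (K.one X)).symm) (K.interchange η η))
        (counitMid ϵ U F) ≪≫
        eqToIso (unit_comp_wr_triangleRight η ϵ)

theorem unitPasting_eq (s : 𝟙 F ≅ triangleLeft η ϵ) (t : triangleRight η ϵ ⟶ 𝟙 U) :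
    unitPasting η ϵ s.hom t =
      (unitPastingLeft s).hom ≫ η ◁ K.wr₃ t F ≫ eqToHom (by simp [K.wr_id]) := by
  simp [unitPasting, unitPastingLeft, wlIso]

theorem exists_pseudoadjunction_of_isLeftPseudoextension
    (h : K.IsLeftPseudoextension F (K.one X) U η)
    (hF : K.PreservesLeftPseudoextension F F (K.one X) U η) :
    ∃ P : Pseudoadjunction F U, P.unit = η := by
  rw [preservesLeftPseudoextension_iff_unitAt] at hF
  rw [isLeftPseudoextension_iff_isEquivalence_restrict] at h hF
  have := h U
  have := hF (K.one A)
  -- The counit is the lift of the identity of `F`; this also provides `s`.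
  obtain ⟨ϵ, ⟨μ⟩⟩ := Functor.EssSurj.mem_essImage (F := K.restrict F (unitAt η F) (K.one A))
    (eqToHom (K.one_comp F).symm)
  let μ' : unitAt η F ≫ K.wr ϵ F ≅ eqToHom (K.one_comp F).symm := μ
  let s : 𝟙 F ≅ triangleLeft η ϵ :=
    eqToIso (by simp) ≪≫ whiskerRightIso μ'.symm (eqToHom (K.one_comp F)) ≪≫
      eqToIso (by simp [triangleLeft_eq, counitWhisker])
  -- `t` is the unique lift of the 3-cell that the first coherence identity prescribes.
  let ω : η ≫ K.wr (triangleRight η ϵ) F ≅ η ≫ K.wr (𝟙 U) F :=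
    (unitPastingLeft s).symm ≪≫ eqToIso (by simp [K.wr_id])
  let t : triangleRight η ϵ ≅ 𝟙 U := (K.restrict F η U).preimageIso ω
  have ht : η ◁ K.wr₃ t.hom F = ω.hom := (K.restrict F η U).map_preimage _
  have hu : unitPasting η ϵ s.hom t.hom = 𝟙 η := by
    rw [unitPasting_eq, ht]
    simp [ω]
  refine ⟨⟨η, ϵ, s, t, hu, ?_⟩, rfl⟩
  apply (K.restrict F (unitAt η F) (K.one A)).map_injective
  rw [CategoryTheory.Functor.map_id]
  exact unitAt_whiskerLeft_wr₃_counitPasting s t hu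

end Construction

/-! ### Duality -/

section Duality

variable {K : GrayCategory.{w, v₂, v₁, u}} {X A : K.Obj} {F : K.Hom X A} {U : K.Hom A X}

/-- `unitPasting` as an invertible 3-cell. -/
def unitPastingIso {η : K.one X ⟶ K.comp U F} {ϵ : K.comp F U ⟶ K.one A}
    (s : 𝟙 F ≅ triangleLeft η ϵ) (t : triangleRight η ϵ ≅ 𝟙 U) : η ≅ η :=
  unitPastingLeft s ≪≫ whiskerLeftIso η (K.wrIso t F) ≪≫ eqToIso (by simp [K.wr_id])

/-- `counitPasting` as an invertible 3-cell. -/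
def counitPastingIso {η : K.one X ⟶ K.comp U F} {ϵ : K.comp F U ⟶ K.one A}
    (s : 𝟙 F ≅ triangleLeft η ϵ) (t : triangleRight η ϵ ≅ 𝟙 U) : ϵ ≅ ϵ :=
  eqToIso (by simp [K.wr_id]) ≪≫ whiskerRightIso (K.wrIso s U) ϵ ≪≫
    eqToIso (wr_triangleLeft_comp_counit η ϵ) ≪≫
      whiskerLeftIso (unitMid η F U)
        (whiskerRightIso (K.interchange ϵ ϵ) (eqToHom (K.comp_one (K.one A)))) ≪≫
        eqToIso (wl_triangleRight_comp_counit η ϵ) ≪≫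
          whiskerRightIso (K.wlIso F t) ϵ ≪≫ eqToIso (by simp [K.wl_id])

theorem unitPastingIso_hom {η : K.one X ⟶ K.comp U F} {ϵ : K.comp F U ⟶ K.one A}
    (s : 𝟙 F ≅ triangleLeft η ϵ) (t : triangleRight η ϵ ≅ 𝟙 U) :
    (unitPastingIso s t).hom = unitPasting η ϵ s.hom t.hom := by
  simp [unitPasting_eq, unitPastingIso, wrIso]

theorem counitPastingIso_hom {η : K.one X ⟶ K.comp U F} {ϵ : K.comp F U ⟶ K.one A}
    (s : 𝟙 F ≅ triangleLeft η ϵ) (t : triangleRight η ϵ ≅ 𝟙 U) :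
    (counitPastingIso s t).hom = counitPasting η ϵ s.hom t.hom := by
  simp [counitPasting, counitPastingIso, wrIso, wlIso]

/-- The pasting `unitPasting` in the horizontal dual is the inverse pasting. -/
theorem unitPasting_op {η : K.one X ⟶ K.comp U F} {ϵ : K.comp F U ⟶ K.one A}
    (s : 𝟙 F ≅ triangleLeft η ϵ) (t : triangleRight η ϵ ≅ 𝟙 U) :
    unitPasting (K := K.op) (F := U) (U := F) η ϵ t.inv s.inv = (unitPastingIso s t).inv := by
  have hmid : cell₂ (C := K.Hom X X) (counitMid (K := K.op) (F := U) (U := F) ϵ F U) =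
      cell₂ (counitMid ϵ U F) := by
    trans cell₂ (K.wl U (K.wr ϵ F))
    · rw [K.cell₂_wl_wr]
      simp [counitMid]
    · simp [counitMid]
  apply cell₃_injective (C := K.Hom X X)
  simp only [unitPasting, unitPastingIso, unitPastingLeft, Iso.trans_inv, eqToIso.inv,
    cell₃_eqToHom_comp, Category.assoc, wlIso, wrIso, whiskerLeftIso_inv, whiskerRightIso_inv]
  refine cell₃_comp rfl ?_
  rw [cell₃_eqToHom_comp, cell₃_eqToHom_comp]
  refine cell₃_comp (cell₃_whiskerRight rfl hmid) ?_
  rw [cell₃_eqToHom_comp, cell₃_eqToHom_comp]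
  exact cell₃_comp rfl (by simp)

/-- The pasting `counitPasting` in the horizontal dual is the inverse pasting. -/
theorem counitPasting_op {η : K.one X ⟶ K.comp U F} {ϵ : K.comp F U ⟶ K.one A}
    (s : 𝟙 F ≅ triangleLeft η ϵ) (t : triangleRight η ϵ ≅ 𝟙 U) :
    counitPasting (K := K.op) (F := U) (U := F) η ϵ t.inv s.inv = (counitPastingIso s t).inv := by
  have hmid : cell₂ (C := K.Hom A A) (unitMid (K := K.op) (F := U) (U := F) η U F) =
      cell₂ (unitMid η F U) := by
    trans cell₂ (K.wl F (K.wr η U))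
    · rw [K.cell₂_wl_wr]
      simp [unitMid]
    · simp [unitMid]
  apply cell₃_injective (C := K.Hom A A)
  simp only [counitPasting, counitPastingIso, Iso.trans_inv, eqToIso.inv,
    cell₃_eqToHom_comp, Category.assoc, wlIso, wrIso, whiskerLeftIso_inv, whiskerRightIso_inv]
  refine cell₃_comp rfl ?_
  rw [cell₃_eqToHom_comp, cell₃_eqToHom_comp]
  refine cell₃_comp (cell₃_whiskerLeft hmid rfl) ?_
  rw [cell₃_eqToHom_comp, cell₃_eqToHom_comp]
  exact cell₃_comp rfl (by simp)

/-- A pseudoadjunction `F ⊣ U` is a pseudoadjunction `U ⊣ F` in the horizontal dual, with the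
roles of `s` and `t` interchanged. -/
def Pseudoadjunction.op (P : Pseudoadjunction F U) : Pseudoadjunction (K := K.op) U F where
  unit := P.unit
  counit := P.counit
  s := P.t.symm
  t := P.s.symm
  unit_coherence := by
    have h : unitPastingIso P.s P.t = Iso.refl _ :=
      Iso.ext ((unitPastingIso_hom ..).trans P.unit_coherence)
    exact (unitPasting_op P.s P.t).trans (by rw [h]; rfl)
  counit_coherence := by
    have h : counitPastingIso P.s P.t = Iso.refl _ :=
      Iso.ext ((counitPastingIso_hom ..).trans P.counit_coherence)
    exact (counitPasting_op P.s P.t).trans (by rw [h]; rfl)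

/-- Both directions are `Pseudoadjunction.op`, as `K.op.op` is `K` by definition. -/
theorem exists_pseudoadjunction_op_iff (η : K.one X ⟶ K.comp U F) :
    (∃ P : Pseudoadjunction (K := K.op) U F, P.unit = η) ↔
      ∃ P : Pseudoadjunction F U, P.unit = η :=
  ⟨fun ⟨P, hP⟩ => ⟨P.op, hP⟩, fun ⟨P, hP⟩ => ⟨P.op, hP⟩⟩

end Duality

end GrayCategory

theorem mainTheorem1 (K : GrayCategory.{w, v₂, v₁, u}) {X A : K.Obj} (U : K.Hom A X)
    (F : K.Hom X A) (η : K.one X ⟶ K.comp U F) :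
    List.TFAE [
      ∃ P : GrayCategory.Pseudoadjunction F U, P.unit = η,
      K.IsAbsoluteLeftPseudoextension F (K.one X) U η,
      K.IsLeftPseudoextension F (K.one X) U η ∧
        K.PreservesLeftPseudoextension F F (K.one X) U η,
      K.IsAbsoluteLeftPseudolifting U (K.one X) F η,
      K.IsLeftPseudolifting U (K.one X) F η ∧
        K.PreservesLeftPseudolifting U U (K.one X) F η] := by
  tfae_have 1 → 2 := by
    rintro ⟨P, rfl⟩
    exact P.isAbsoluteLeftPseudoextension
  tfae_have 2 → 3 := fun h => ⟨h.1, h.2 _ F⟩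
  tfae_have 3 → 1 := fun h =>
    GrayCategory.exists_pseudoadjunction_of_isLeftPseudoextension h.1 h.2
  tfae_have 1 → 4 := by
    rintro ⟨P, rfl⟩
    exact P.op.isAbsoluteLeftPseudoextension
  tfae_have 4 → 5 := fun h => ⟨h.1, h.2 _ U⟩
  tfae_have 5 → 1 := fun h => (GrayCategory.exists_pseudoadjunction_op_iff η).1
    (GrayCategory.exists_pseudoadjunction_of_isLeftPseudoextension (K := K.op) h.1 h.2)
  tfae_finish
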